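/- **Setting.** Let $d,L\ge 1$ and consider a periodic chain of $2L$ qudits with sites $x\in\mathbb Z_{2L}$ and local space $\mathbb C^d$. Let $U,V$ be gates on $\mathbb C^d\otimes\mathbb C^d$ that are dual-unitary: $U$ and its reshuffling $\tilde U$, $\langle i,j|\tilde U|k,l\rangle=\langle l,j|U|k,i\rangle$, are both unitary, and likewise $V,\tilde V$. The brickwork Floquet operator $\mathbb U$ first applies $U$ to every pair of sites $(2j,2j+1)$ and then $V$ to every pair $(2j+1,2j+2)$. For $w\ge 1$ let $\mathcal A_w$ be the algebra of matrices on $(\mathbb C^d)^{\otimes w}$ (sites $0,\dots,w-1$) and $\bar{\mathcal A}_w\subseteq\mathcal A_w$ the subspace of those whose partial traces over site $0$ and over site $w-1$ both vanish; $\boldsymbol a_{x,\dots,x+w-1}$ denotes $\boldsymbol a\in\mathcal A_w$ acting on the sites $x,\dots,x+w-1$ of the chain and as the identity elsewhere. For odd $w$ define on $\mathcal A_w$ $$\mathcal M_{+,w}(\boldsymbol a)=\tfrac1{d^2}\operatorname{tr}_1\!\Big[V^{\otimes\frac{w+1}2}\Big(\operatorname{tr}_0\!\big[U^{\otimes\frac{w+1}2}(\boldsymbol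 a\otimes\mathbb 1)U^{\dagger\otimes\frac{w+1}2}\big]\otimes\mathbb 1\Big)V^{\dagger\otimes\frac{w+1}2}\Big],$$ $$\mathcal M_{-,w}(\boldsymbol a)=\tfrac1{d^2}\operatorname{tr}_{w-1}\!\Big[V^{\otimes\frac{w+1}2}\Big(\mathbb 1\otimes\operatorname{tr}_w\!\big[U^{\otimes\frac{w+1}2}(\mathbb 1\otimes\boldsymbol a)U^{\dagger\otimes\frac{w+1}2}\big]\Big)V^{\dagger\otimes\frac{w+1}2}\Big],$$ where in $\mathcal M_{+,w}$ each partial trace is over the leftmost, and in $\mathcal M_{-,w}$ over the rightmost, of the $w+1$ sites present. For each odd $w\le L-4$ let $\{\boldsymbol a_{k,w}\}_k$ be a linearly independent family of elements of $\bar{\mathcal A}_w$ with $\mathcal M_{+,w}(\boldsymbol a_{k,w})=\lambda^+_{k,w}\boldsymbol a_{k,w}$, $|\lambda^+_{k,w}|=1$, whose span contains every eigenvector of $\mathcal M_{+,w}$ in $\bar{\mathcal A}_w$ with unimodular eigenvalue; let $\{\boldsymbol b_{l,w}\}_l$, with phases $\lambda^-_{l,w}$, be such a family for $\mathcal M_{-,w}$.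 (Such families always exist.) Put $$Q^+_{k,w}=\sum_{n=0}^{L-1}(\lambda^+_{k,w})^{n}\,[\boldsymbol a_{k,w}]_{2n,\dots,2n+w-1},\qquad Q^-_{l,w}=\sum_{n=0}^{L-1}(\lambda^-_{l,w})^{-n}\,[\boldsymbol b_{l,w}]_{2n+1,\dots,2n+w}.$$ **Theorem (fundamental charges for dual-unitary circuits).** Let $\mathcal Q$ satisfy $\mathbb U\mathcal Q\mathbb U^\dagger=\mathcal Q$ and $$\mathcal Q=\sum_{1\le w\le L-4}\ \sum_{x\in\mathbb Z_{2L}}\boldsymbol q(x,w)_{x,\dots,x+w-1},\qquad \boldsymbol q(x,w)\in\bar{\mathcal A}_w .$$ Then there are complex coefficients $\alpha_{k,w},\beta_{l,w}$, with $\alpha_{k,w}=0$ unless $(\lambda^+_{k,w})^L=1$ and $\beta_{l,w}=0$ unless $(\lambda^-_{l,w})^L=1$, such that $$\mathcal Q=\sum_{\substack{1\le w\le L-4\\ w\text{ odd}}}\Big(\sum_k\alpha_{k,w}Q^+_{k,w}+\sum_l\beta_{l,w}Q^-_{l,w}\Big).$$ Here, for all odd $w\le L-4$, the $\boldsymbol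 a_{k,w}$ and $\boldsymbol b_{l,w}$ are indeed right- and left-moving solitons of $\mathbb U$, i.e. $\mathbb U[\boldsymbol a_{k,w}]_{x,\dots,x+w-1}\mathbb U^\dagger=\lambda^+_{k,w}[\boldsymbol a_{k,w}]_{x+2,\dots,x+w+1}$ for all even $x$ and $\mathbb U[\boldsymbol b_{l,w}]_{x,\dots,x+w-1}\mathbb U^\dagger=\lambda^-_{l,w}[\boldsymbol b_{l,w}]_{x-2,\dots,x+w-3}$ for all odd $x$; and $Q^+_{k,w}$ (resp. $Q^-_{l,w}$) is conserved, $\mathbb UQ^\pm\mathbb U^\dagger=Q^\pm$, whenever $(\lambda^+_{k,w})^L=1$ (resp. $(\lambda^-_{l,w})^L=1$). -/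

import Mathlib

/-! Brickwork dual-unitary circuits on a ring of `2 * L` qudits of dimension `d`, in the
computational basis: a basis state of `n` qudits is a function from the sites to `Fin d`. -/

/-- Gates on two qudits; `G (i, j) (k, l)` is the matrix element `⟨i| ⊗ ⟨j| G |k⟩ ⊗ |l⟩`. -/
abbrev Gate (d : ℕ) := Matrix (Fin d × Fin d) (Fin d × Fin d) ℂ

/-- The algebra `𝒜_w` of all matrices acting on an open row of `w` qudits, at sites `0, …, w - 1`. -/
abbrev LocalOp (d w : ℕ) := Matrix (Fin w → Fin d) (Fin w → Fin d) ℂ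

/-- The algebra of all matrices acting on the periodic chain with sites `ZMod (2 * L)`. -/
abbrev ChainOp (d L : ℕ) := Matrix (ZMod (2 * L) → Fin d) (ZMod (2 * L) → Fin d) ℂ

/-- The space-time dual of a gate: `⟨i j| G̃ |k l⟩ = ⟨l j| G |k i⟩`. -/
def dualGate {d : ℕ} (G : Gate d) : Gate d :=
  fun p q => G (q.2, p.2) (q.1, p.1)

/-- A gate is dual-unitary if it and its space-time dual are both unitary. -/
def IsDualUnitary {d : ℕ} (G : Gate d) : Prop :=
  G ∈ Matrix.unitaryGroup (Fin d × Fin d) ℂ ∧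
    dualGate G ∈ Matrix.unitaryGroup (Fin d × Fin d) ℂ

/-- The tensor power `G ^ ⊗L` on the chain, translated by `r` sites: one copy of `G` acts on
each of the pairs of sites `(2 j + r, 2 j + r + 1)`, `j = 0, …, L - 1`. -/
def chainLayer {d : ℕ} (L : ℕ) (G : Gate d) (r : ZMod (2 * L)) : ChainOp d L :=
  fun s t => ∏ j : Fin L,
    G (s (2 * (j : ℕ) + r), s (2 * (j : ℕ) + r + 1)) (t (2 * (j : ℕ) + r), t (2 * (j : ℕ) + r + 1))

/-- The brickwork Floquet operator: first `U` on all pairs `(2 j, 2 j + 1)`, then `V` on all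
pairs `(2 j + 1, 2 j + 2)`. -/
def floquet {d : ℕ} (L : ℕ) [NeZero L] (U V : Gate d) : ChainOp d L :=
  chainLayer L V 1 * chainLayer L U 0

open Classical in
/-- The operator `a_{x, …, x + w - 1}` on the chain that acts as `a` on the sites
`x, …, x + w - 1` and as the identity on all others (for `w ≤ 2 * L`). -/
noncomputable def placeAt {d L w : ℕ} (x : ZMod (2 * L)) (a : LocalOp d w) : ChainOp d L :=
  fun s t => a (fun i => s (x + (i : ℕ))) (fun i => t (x + (i : ℕ))) *
    if ∀ y, (∀ i : Fin w, y ≠ x + (i : ℕ)) → s y = t y then 1 else 0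

/-- The partial trace of `a` over the site `j` vanishes. -/
def IsTracelessAt {d w : ℕ} (a : LocalOp d w) (j : Fin w) : Prop :=
  ∀ s t : Fin w → Fin d, ∑ i : Fin d, a (Function.update s j i) (Function.update t j i) = 0

/-- Membership in `𝒜̄_w`: the partial traces over both boundary sites `0` and `w - 1` vanish. -/
def IsBoundaryTraceless {d w : ℕ} (a : LocalOp d w) : Prop :=
  ∀ j : Fin w, ((j : ℕ) = 0 ∨ (j : ℕ) + 1 = w) → IsTracelessAt a j

/-- The tensor power `G ^ ⊗(n / 2)` on an open row of an even number `n` of sites: one copy of `G`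
acts on each of the pairs `(2 j, 2 j + 1)`. -/
def rowLayer {d : ℕ} (n : ℕ) (G : Gate d) : LocalOp d n :=
  fun s t => ∏ j : Fin (n / 2),
    G (s ⟨2 * j, by omega⟩, s ⟨2 * j + 1, by omega⟩) (t ⟨2 * j, by omega⟩, t ⟨2 * j + 1, by omega⟩)

/-- `a ⊗ 𝟙`. -/
def tensorOne {d w : ℕ} (a : LocalOp d w) : LocalOp d (w + 1) :=
  fun s t => a (fun i => s i.castSucc) (fun i => t i.castSucc) *
    if s (Fin.last w) = t (Fin.last w) then 1 else 0

/-- `𝟙 ⊗ a`. -/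
def oneTensor {d w : ℕ} (a : LocalOp d w) : LocalOp d (w + 1) :=
  fun s t => (if s 0 = t 0 then 1 else 0) * a (fun i => s i.succ) (fun i => t i.succ)

/-- The partial trace over the first site. -/
def traceFirst {d w : ℕ} (A : LocalOp d (w + 1)) : LocalOp d w :=
  fun s t => ∑ i : Fin d, A (Fin.cons i s) (Fin.cons i t)

/-- The partial trace over the last site. -/
def traceLast {d w : ℕ} (A : LocalOp d (w + 1)) : LocalOp d w :=
  fun s t => ∑ i : Fin d, A (Fin.snoc s i) (Fin.snoc t i)

/-- The map `𝓜_{+,w}`, for `w` odd. -/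
noncomputable def rightMap {d : ℕ} (U V : Gate d) (w : ℕ) (a : LocalOp d w) : LocalOp d w :=
  ((1 : ℂ) / (d : ℂ) ^ 2) •
    traceFirst (rowLayer (w + 1) V *
      tensorOne (traceFirst (rowLayer (w + 1) U * tensorOne a * (rowLayer (w + 1) U).conjTranspose)) *
      (rowLayer (w + 1) V).conjTranspose)

/-- The map `𝓜_{-,w}`, for `w` odd. -/
noncomputable def leftMap {d : ℕ} (U V : Gate d) (w : ℕ) (a : LocalOp d w) : LocalOp d w :=
  ((1 : ℂ) / (d : ℂ) ^ 2) •
    traceLast (rowLayer (w + 1) V *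
      oneTensor (traceLast (rowLayer (w + 1) U * oneTensor a * (rowLayer (w + 1) U).conjTranspose)) *
      (rowLayer (w + 1) V).conjTranspose)

/-- The family `a₀, …, a_{r-1}`, with phases `lam₀, …, lam_{r-1}`, is a complete linearly independent
set of solitons of the map `M` on `𝒜_w`: it consists of eigenvectors of `M` in `𝒜̄_w` with unimodular
eigenvalues, and every such eigenvector is a linear combination of its members. -/
structure IsSolitonBasis {d w : ℕ} (M : LocalOp d w → LocalOp d w) {r : ℕ}
    (a : Fin r → LocalOp d w) (lam : Fin r → ℂ) : Prop where
  traceless : ∀ k, IsBoundaryTraceless (a k)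
  eigen : ∀ k, M (a k) = lam k • a k
  unimodular : ∀ k, ‖lam k‖ = 1
  linearIndependent : LinearIndependent ℂ a
  complete : ∀ (b : LocalOp d w) (mu : ℂ), IsBoundaryTraceless b → ‖mu‖ = 1 → M b = mu • b →
    b ∈ Submodule.span ℂ (Set.range a)

/-- Such a family exists for every map. -/
theorem exists_isSolitonBasis {d w : ℕ} (M : LocalOp d w → LocalOp d w) :
    ∃ (r : ℕ) (a : Fin r → LocalOp d w) (lam : Fin r → ℂ), IsSolitonBasis M a lam := by
  obtain ⟨B, hB, hspan, hli⟩ := exists_linearIndependent ℂ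
    {b : LocalOp d w | IsBoundaryTraceless b ∧ ∃ mu : ℂ, ‖mu‖ = 1 ∧ M b = mu • b}
  have : Finite B := hli.finite
  obtain ⟨r, ⟨e⟩⟩ := Finite.exists_equiv_fin B
  choose mu h1 h2 using fun x : B => (hB x.2).2
  refine ⟨r, fun k => (e.symm k : LocalOp d w), fun k => mu (e.symm k),
    ⟨fun k => (hB (e.symm k).2).1, fun k => h2 _, fun k => h1 _,
      hli.comp _ e.symm.injective, fun b m hb hm hM => ?_⟩⟩
  have hr : Set.range (fun k => (e.symm k : LocalOp d w)) = B := by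
    ext x
    constructor
    · rintro ⟨k, rfl⟩
      exact (e.symm k).2
    · intro hx
      exact ⟨e ⟨x, hx⟩, by simp⟩
  rw [hr, hspan]
  exact Submodule.subset_span ⟨hb, m, hm, hM⟩

/-- `Q` is conserved by the unitary `W`. -/
def IsConserved {d L : ℕ} [NeZero L] (W Q : ChainOp d L) : Prop :=
  W * Q * W.conjTranspose = Q

/-- `a` is a right-moving width-`w` soliton of `W` with phase `lam`. -/
def IsRightSoliton {d L w : ℕ} [NeZero L] (W : ChainOp d L) (a : LocalOp d w) (lam : ℂ) : Prop :=
  IsBoundaryTraceless a ∧ ‖lam‖ = 1 ∧ ∀ x : ZMod (2 * L), Even x →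
    W * placeAt x a * W.conjTranspose = lam • placeAt (x + 2) a

/-- `b` is a left-moving width-`w` soliton of `W` with phase `lam`. -/
def IsLeftSoliton {d L w : ℕ} [NeZero L] (W : ChainOp d L) (b : LocalOp d w) (lam : ℂ) : Prop :=
  IsBoundaryTraceless b ∧ ‖lam‖ = 1 ∧ ∀ x : ZMod (2 * L), Odd x →
    W * placeAt x b * W.conjTranspose = lam • placeAt (x - 2) b

/-- `Q⁺ = ∑_{x even} lam ^ (x / 2) a_{x, …, x + w - 1}`, with `x = 2 n`. -/
noncomputable def rightCharge {d w : ℕ} (L : ℕ) (a : LocalOp d w) (lam : ℂ) : ChainOp d L :=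
  ∑ n : Fin L, lam ^ (n : ℕ) • placeAt (2 * (n : ℕ) : ZMod (2 * L)) a

/-- `Q⁻ = ∑_{x odd} lam ^ (-(x - 1) / 2) b_{x, …, x + w - 1}`, with `x = 2 n + 1`. -/
noncomputable def leftCharge {d w : ℕ} (L : ℕ) (b : LocalOp d w) (lam : ℂ) : ChainOp d L :=
  ∑ n : Fin L, lam⁻¹ ^ (n : ℕ) • placeAt (2 * (n : ℕ) + 1 : ZMod (2 * L)) b

/-! Conjugation by the Floquet operator, `E`, preserves the Hilbert–Schmidt inner product `hs`. Call
the placed densities `F w x` bands: they act trivially off their arc and are traceless at both ends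
of it. Averaging over a site (`siteAvg`) is self-adjoint, so an operator that is trivial at a site
is orthogonal to one that is traceless there. Bands with different starts or widths are therefore
orthogonal, the widths being too small for two arcs to close up around the ring.

Dual-unitarity enters through one fact (`gateAvgRight_conj`, `gateAvgLeft_conj`): an operator that
is traceless on one leg of a gate and trivial on the other becomes traceless on the other leg. Two
layers in succession (`isBrickStep_comp`) then show that under `E` a right end on an even site moves
exactly two sites to the right, and a left end on an odd site exactly two to the left. The inverse
evolution obeys the same rule with the parities exchanged. These four rules restrict which overlaps
`hs (F w' x') (E (F w x))` can be nonzero.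

Pairing the conservation law with `F w' x'` writes its squared norm as the sum of these overlaps
(`hs_self_eq_sum`). A band of even start and even width can only be fed by one four sites wider, so
all of these vanish, from the widest down. After that, a band of even start is fed only by the band
of its own width at `x' - 2`. The squared distance of `F w x'` from `E (F w (x' - 2))` is then a
difference of consecutive squared norms, and its sum around the ring is zero; hence `E` translates
these bands by two sites. Bands of odd start and odd width are translated to the left by the same
argument. Bands of odd start and even width can only be fed by ones four sites narrower, and vanish
from the narrowest up.

It remains to relate `E` to the maps on local operators. These are compressions of `E` to operators
on the translated arc (`hs_floquet_right`, `hs_floquet_left`). A unimodular eigenvector loses no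
norm under the compression, so `E` itself multiplies it by the phase and translates it: it is a
soliton. Conversely the densities of a conserved quantity satisfy `M (q x) = q (x ± 2)`, hence `M ^
L` fixes them, and a discrete Fourier transform over the orbit resolves them into unimodular
eigenvectors (`IsSolitonBasis.exists_coeff`). -/

section Ring

/-! ### Arcs on the ring of sites. -/

theorem zmod_natCast_inj {n a b : ℕ} (ha : a < n) (hb : b < n)
    (h : (a : ZMod n) = (b : ZMod n)) : a = b := by
  rw [ZMod.natCast_eq_natCast_iff'] at h
  rwa [Nat.mod_eq_of_lt ha, Nat.mod_eq_of_lt hb] at h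

theorem add_fin_injective {n w : ℕ} (hw : w ≤ n) (x : ZMod n) :
    Function.Injective (fun i : Fin w => x + ((i : ℕ) : ZMod n)) := by
  intro i j h
  exact Fin.ext (zmod_natCast_inj (i.2.trans_le hw) (j.2.trans_le hw) (add_left_cancel h))

theorem two_mul_natCast_self (L : ℕ) : (2 : ZMod (2 * L)) * (L : ZMod (2 * L)) = 0 := by
  have : ((2 * L : ℕ) : ZMod (2 * L)) = 0 := ZMod.natCast_self _
  exact_mod_cast this

theorem zmod_two_mul_even_or_odd {L : ℕ} [NeZero L] (x : ZMod (2 * L)) : Even x ∨ Odd x := by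
  rw [← ZMod.natCast_zmod_val x]
  rcases Nat.even_or_odd x.val with h | h
  · exact Or.inl (h.natCast)
  · exact Or.inr (h.natCast)

/-- The site `y` lies off the arc of `w` sites that starts at `x`. -/
def OffArc {n : ℕ} (x : ZMod n) (w : ℕ) (y : ZMod n) : Prop :=
  ∀ i : Fin w, y ≠ x + ((i : ℕ) : ZMod n)

theorem OffArc.ne {n w : ℕ} {x y : ZMod n} (h : OffArc x w y) {i : ℕ} (hi : i < w) :
    y ≠ x + (i : ZMod n) := h ⟨i, hi⟩

theorem exists_of_not_offArc {n w : ℕ} {x y : ZMod n} (h : ¬ OffArc x w y) :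
    ∃ i < w, y = x + (i : ZMod n) := by
  simp only [OffArc, not_forall, not_not] at h
  obtain ⟨i, hi⟩ := h
  exact ⟨i, i.2, hi⟩

theorem offArc_iff {n w : ℕ} {x y : ZMod n} :
    OffArc x w y ↔ ∀ i < w, y ≠ x + (i : ZMod n) :=
  ⟨fun h _ hi => h.ne hi, fun h i => h i i.2⟩

/-- A site at distance `k` beyond the start of the arc, with `w ≤ k < n`, lies off it. -/
theorem offArc_add {n w k : ℕ} (x : ZMod n) (h1 : w ≤ k) (h2 : k < n) :
    OffArc x w (x + (k : ZMod n)) := by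
  intro i h
  have := zmod_natCast_inj h2 (by omega) (add_left_cancel h)
  omega

theorem offArc_sub {n w k : ℕ} (x : ZMod n) (h1 : 1 ≤ k) (h2 : w + k ≤ n) :
    OffArc x w (x - (k : ZMod n)) := by
  have := offArc_add (n := n) (w := w) (k := n - k) x (by omega) (by omega)
  rw [Nat.cast_sub (by omega), ZMod.natCast_self] at this
  convert this using 1
  ring

theorem offArc_succ_iff {n w : ℕ} {x y : ZMod n} :
    OffArc x (w + 1) y ↔ y ≠ x ∧ OffArc (x + 1) w y := by
  simp only [OffArc, Fin.forall_fin_succ]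
  simp [add_left_comm, add_comm]

theorem offArc_succ_iff_last {n w : ℕ} {x y : ZMod n} :
    OffArc x (w + 1) y ↔ OffArc x w y ∧ y ≠ x + (w : ZMod n) := by
  simp only [OffArc, Fin.forall_fin_succ']
  simp

end Ring

/-! ### Embedding local operators into the chain. -/

section Place

variable {d L w : ℕ}

/-- Restriction of a configuration of the chain to the arc of `w` sites that starts at `x`. -/
def restrictArc (x : ZMod (2 * L)) (w : ℕ) (s : ZMod (2 * L) → Fin d) : Fin w → Fin d :=
  fun i => s (x + ((i : ℕ) : ZMod (2 * L)))

/-- The configurations `s` and `t` agree off the arc. -/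
def AgreeOff (x : ZMod (2 * L)) (w : ℕ) (s t : ZMod (2 * L) → Fin d) : Prop :=
  ∀ y, OffArc x w y → s y = t y

open Classical in
theorem placeAt_apply (x : ZMod (2 * L)) (a : LocalOp d w) (s t : ZMod (2 * L) → Fin d) :
    placeAt x a s t = a (restrictArc x w s) (restrictArc x w t) *
      if AgreeOff x w s t then 1 else 0 := rfl

theorem placeAt_of_agree {x : ZMod (2 * L)} (a : LocalOp d w) {s t : ZMod (2 * L) → Fin d}
    (h : AgreeOff x w s t) :
    placeAt x a s t = a (restrictArc x w s) (restrictArc x w t) := by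
  rw [placeAt_apply, if_pos h, mul_one]

theorem placeAt_of_not_agree {x : ZMod (2 * L)} (a : LocalOp d w) {s t : ZMod (2 * L) → Fin d}
    (h : ¬ AgreeOff x w s t) : placeAt x a s t = 0 := by
  rw [placeAt_apply, if_neg h, mul_zero]

theorem placeAt_congr {x : ZMod (2 * L)} {a b : LocalOp d w} {s t s' t' : ZMod (2 * L) → Fin d}
    (h : a (restrictArc x w s) (restrictArc x w t) = b (restrictArc x w s') (restrictArc x w t'))
    (h' : AgreeOff x w s t ↔ AgreeOff x w s' t') : placeAt x a s t = placeAt x b s' t' := by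
  by_cases h1 : AgreeOff x w s t
  · rw [placeAt_of_agree _ h1, placeAt_of_agree _ (h'.1 h1), h]
  · rw [placeAt_of_not_agree _ h1, placeAt_of_not_agree _ (mt h'.2 h1)]

open Classical in
/-- The configuration equal to `v` on the arc and to `t` off it. -/
noncomputable def glue (x : ZMod (2 * L)) (v : Fin w → Fin d) (t : ZMod (2 * L) → Fin d) :
    ZMod (2 * L) → Fin d :=
  fun y => if h : ∃ i : Fin w, y = x + ((i : ℕ) : ZMod (2 * L)) then v h.choose else t y

theorem glue_off (x : ZMod (2 * L)) (v : Fin w → Fin d) (t : ZMod (2 * L) → Fin d)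
    {y : ZMod (2 * L)} (hy : OffArc x w y) : glue x v t y = t y := by
  rw [glue, dif_neg]
  rintro ⟨i, hi⟩
  exact hy i hi

theorem restrictArc_glue (hw : w ≤ 2 * L) (x : ZMod (2 * L)) (v : Fin w → Fin d)
    (t : ZMod (2 * L) → Fin d) : restrictArc x w (glue x v t) = v := by
  funext i
  have h : ∃ j : Fin w, x + ((i : ℕ) : ZMod (2 * L)) = x + ((j : ℕ) : ZMod (2 * L)) := ⟨i, rfl⟩
  simp only [restrictArc, glue, dif_pos h]
  rw [← add_fin_injective hw x h.choose_spec]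

theorem agreeOff_glue (x : ZMod (2 * L)) (v : Fin w → Fin d) (t : ZMod (2 * L) → Fin d) :
    AgreeOff x w (glue x v t) t := fun _ hy => glue_off x v t hy

theorem AgreeOff.symm {x : ZMod (2 * L)} {s t : ZMod (2 * L) → Fin d} (h : AgreeOff x w s t) :
    AgreeOff x w t s := fun y hy => (h y hy).symm

theorem AgreeOff.trans {x : ZMod (2 * L)} {s t u : ZMod (2 * L) → Fin d} (h : AgreeOff x w s t)
    (h' : AgreeOff x w t u) : AgreeOff x w s u := fun y hy => (h y hy).trans (h' y hy)

theorem eq_of_restrictArc_eq {x : ZMod (2 * L)} {s t : ZMod (2 * L) → Fin d}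
    (h : AgreeOff x w s t) (h' : restrictArc x w s = restrictArc x w t) : s = t := by
  funext y
  by_cases hy : OffArc x w y
  · exact h y hy
  · obtain ⟨i, hi, rfl⟩ := exists_of_not_offArc hy
    exact congrFun h' ⟨i, hi⟩

theorem placeAt_add (x : ZMod (2 * L)) (a b : LocalOp d w) :
    placeAt x (a + b) = placeAt x a + placeAt x b := by
  ext s t
  simp only [placeAt_apply, Matrix.add_apply, add_mul]

theorem placeAt_smul (x : ZMod (2 * L)) (c : ℂ) (a : LocalOp d w) :
    placeAt x (c • a) = c • placeAt x a := by
  ext s t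
  simp only [placeAt_apply, Matrix.smul_apply, smul_eq_mul, mul_assoc]

/-- `placeAt x` as a linear map. -/
noncomputable def placeAtLin (x : ZMod (2 * L)) : LocalOp d w →ₗ[ℂ] ChainOp d L where
  toFun := placeAt x
  map_add' := placeAt_add x
  map_smul' := placeAt_smul x

theorem placeAtLin_apply (x : ZMod (2 * L)) (a : LocalOp d w) : placeAtLin x a = placeAt x a := rfl

theorem placeAt_sub (x : ZMod (2 * L)) (a b : LocalOp d w) :
    placeAt x (a - b) = placeAt x a - placeAt x b := map_sub (placeAtLin x) a b

theorem placeAt_conjTranspose (x : ZMod (2 * L)) (a : LocalOp d w) :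
    placeAt x a.conjTranspose = (placeAt x a).conjTranspose := by
  ext s t
  rw [Matrix.conjTranspose_apply]
  by_cases h : AgreeOff x w s t
  · rw [placeAt_of_agree _ h, placeAt_of_agree _ h.symm, Matrix.conjTranspose_apply]
  · rw [placeAt_of_not_agree _ h, placeAt_of_not_agree _ (fun h' => h h'.symm), star_zero]

theorem placeAt_injective [NeZero d] (hw : w ≤ 2 * L) (x : ZMod (2 * L)) {a b : LocalOp d w}
    (h : placeAt x a = placeAt x b) : a = b := by
  ext u v
  have := congrFun (congrFun h (glue x u 0)) (glue x v 0)
  rwa [placeAt_of_agree _ ((agreeOff_glue x u 0).trans (agreeOff_glue x v 0).symm),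
    placeAt_of_agree _ ((agreeOff_glue x u 0).trans (agreeOff_glue x v 0).symm),
    restrictArc_glue hw, restrictArc_glue hw] at this

/-- Only intermediate configurations that agree with `s` off the arc contribute. They are the `glue
x v s`, one for each local configuration `v`. -/
theorem placeAt_mul [NeZero L] (hw : w ≤ 2 * L) (x : ZMod (2 * L)) (a b : LocalOp d w) :
    placeAt x (a * b) = placeAt x a * placeAt x b := by
  ext s t
  rw [Matrix.mul_apply]
  by_cases h : AgreeOff x w s t
  · rw [placeAt_of_agree _ h, Matrix.mul_apply]
    refine Finset.sum_of_injOn (fun v => glue x v s) ?_ ?_ ?_ ?_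
    · intro u _ v _ huv
      have := congrArg (restrictArc x w) huv
      simpa [restrictArc_glue hw] using this
    · intro u _
      simp
    · intro u _ hu
      rw [placeAt_of_not_agree a, zero_mul]
      intro h'
      refine hu ⟨restrictArc x w u, by simp, ?_⟩
      exact eq_of_restrictArc_eq ((agreeOff_glue _ _ _).trans h') (restrictArc_glue hw _ _ _)
    · intro v _
      rw [placeAt_of_agree _ (agreeOff_glue x v s).symm,
        placeAt_of_agree _ ((agreeOff_glue x v s).trans h), restrictArc_glue hw]
  · rw [placeAt_of_not_agree _ h]
    refine (Finset.sum_eq_zero fun u _ => ?_).symm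
    by_cases h1 : AgreeOff x w s u
    · rw [placeAt_of_not_agree b (fun h2 => h (h1.trans h2)), mul_zero]
    · rw [placeAt_of_not_agree a h1, zero_mul]

/-- With `placeAt_oneTensor`, this pads an operator of odd width to an even number of sites, on
which a row of gates fits. -/
theorem placeAt_tensorOne (hw : w + 1 ≤ 2 * L) (x : ZMod (2 * L)) (a : LocalOp d w) :
    placeAt x (tensorOne a) = placeAt x a := by
  ext s t
  have key : AgreeOff x w s t ↔ AgreeOff x (w + 1) s t ∧
      s (x + (w : ZMod (2 * L))) = t (x + (w : ZMod (2 * L))) := by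
    constructor
    · intro h
      exact ⟨fun y hy => h y (offArc_succ_iff_last.1 hy).1, h _ (offArc_add x le_rfl (by omega))⟩
    · rintro ⟨h1, h2⟩ y hy
      by_cases hyw : y = x + (w : ZMod (2 * L))
      · rw [hyw, h2]
      · exact h1 y (offArc_succ_iff_last.2 ⟨hy, hyw⟩)
  by_cases h : AgreeOff x w s t
  · rw [placeAt_of_agree _ h, placeAt_of_agree _ (key.1 h).1, tensorOne]
    have hl : restrictArc x (w + 1) s (Fin.last w) = restrictArc x (w + 1) t (Fin.last w) :=
      (key.1 h).2
    rw [if_pos hl, mul_one]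
    rfl
  · rw [placeAt_of_not_agree _ h]
    by_cases h1 : AgreeOff x (w + 1) s t
    · rw [placeAt_of_agree _ h1, tensorOne]
      exact mul_eq_zero_of_right _ (if_neg fun h2 => h (key.2 ⟨h1, h2⟩))
    · rw [placeAt_of_not_agree _ h1]

theorem placeAt_oneTensor (hw : w + 1 ≤ 2 * L) (x : ZMod (2 * L)) (a : LocalOp d w) :
    placeAt x (oneTensor a) = placeAt (x + 1) a := by
  ext s t
  have key : AgreeOff (x + 1) w s t ↔ AgreeOff x (w + 1) s t ∧ s x = t x := by
    constructor
    · intro h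
      refine ⟨fun y hy => h y (offArc_succ_iff.1 hy).2, h _ ?_⟩
      have := offArc_sub (x + 1) (k := 1) (w := w) le_rfl hw
      rwa [Nat.cast_one, add_sub_cancel_right] at this
    · rintro ⟨h1, h2⟩ y hy
      by_cases hyw : y = x
      · rw [hyw, h2]
      · exact h1 y (offArc_succ_iff.2 ⟨hyw, hy⟩)
  have hr : ∀ s : ZMod (2 * L) → Fin d,
      (fun i : Fin w => restrictArc x (w + 1) s i.succ) = restrictArc (x + 1) w s := by
    intro s
    funext i
    simp [restrictArc, add_left_comm, add_comm]
  have h0 : ∀ s : ZMod (2 * L) → Fin d, restrictArc x (w + 1) s 0 = s x := by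
    intro s
    simp [restrictArc]
  by_cases h : AgreeOff (x + 1) w s t
  · rw [placeAt_of_agree _ h, placeAt_of_agree _ (key.1 h).1, oneTensor, hr, hr, h0, h0,
      if_pos (key.1 h).2, one_mul]
  · rw [placeAt_of_not_agree _ h]
    by_cases h1 : AgreeOff x (w + 1) s t
    · rw [placeAt_of_agree _ h1, oneTensor, h0, h0, if_neg fun h2 => h (key.2 ⟨h1, h2⟩), zero_mul]
    · rw [placeAt_of_not_agree _ h1]

end Place

/-! ### Site averages and the Hilbert–Schmidt inner product. -/

section SiteAverage

variable {d L w : ℕ}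

/-- The normalized partial trace over the site `y`, tensored with the identity at `y`. -/
noncomputable def siteAvg (y : ZMod (2 * L)) : ChainOp d L →ₗ[ℂ] ChainOp d L where
  toFun A := fun s t => if s y = t y then
    (d : ℂ)⁻¹ * ∑ i, A (Function.update s y i) (Function.update t y i) else 0
  map_add' A B := by
    ext s t
    change (if s y = t y then (d : ℂ)⁻¹ * ∑ i, (A (Function.update s y i) (Function.update t y i) +
      B (Function.update s y i) (Function.update t y i)) else 0) =
      (if s y = t y then (d : ℂ)⁻¹ * ∑ i, A (Function.update s y i) (Function.update t y i) else 0) +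
      (if s y = t y then (d : ℂ)⁻¹ * ∑ i, B (Function.update s y i) (Function.update t y i) else 0)
    rw [Finset.sum_add_distrib, mul_add]
    split_ifs <;> simp
  map_smul' c A := by
    ext s t
    change (if s y = t y then
      (d : ℂ)⁻¹ * ∑ i, (c * A (Function.update s y i) (Function.update t y i)) else 0) =
      c * (if s y = t y then (d : ℂ)⁻¹ * ∑ i, A (Function.update s y i) (Function.update t y i) else 0)
    rw [← Finset.mul_sum]
    split_ifs <;> ring

theorem siteAvg_apply (y : ZMod (2 * L)) (A : ChainOp d L) (s t : ZMod (2 * L) → Fin d) :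
    siteAvg y A s t = if s y = t y then
      (d : ℂ)⁻¹ * ∑ i, A (Function.update s y i) (Function.update t y i) else 0 := rfl

theorem restrictArc_update_off {x y : ZMod (2 * L)} (hy : OffArc x w y)
    (s : ZMod (2 * L) → Fin d) (i : Fin d) :
    restrictArc x w (Function.update s y i) = restrictArc x w s := by
  funext k
  simp only [restrictArc]
  rw [Function.update_of_ne (hy k).symm]

theorem restrictArc_update_on (hw : w ≤ 2 * L) (x : ZMod (2 * L)) (k : Fin w)
    (s : ZMod (2 * L) → Fin d) (i : Fin d) :
    restrictArc x w (Function.update s (x + ((k : ℕ) : ZMod (2 * L))) i) =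
      Function.update (restrictArc x w s) k i := by
  funext l
  simp only [restrictArc]
  by_cases h : l = k
  · subst h
    simp
  · rw [Function.update_of_ne h, Function.update_of_ne]
    · rfl
    · exact fun h' => h (add_fin_injective hw x h')

theorem agreeOff_update_on {x y : ZMod (2 * L)} (hy : ¬ OffArc x w y)
    (s t : ZMod (2 * L) → Fin d) (i j : Fin d) :
    AgreeOff x w (Function.update s y i) (Function.update t y j) ↔ AgreeOff x w s t := by
  refine forall_congr' fun z => forall_congr' fun hz => ?_
  have : z ≠ y := fun h => hy (h ▸ hz)
  rw [Function.update_of_ne this, Function.update_of_ne this]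

theorem agreeOff_update_same {x y : ZMod (2 * L)} {s t : ZMod (2 * L) → Fin d}
    (h : s y = t y) (i : Fin d) :
    AgreeOff x w (Function.update s y i) (Function.update t y i) ↔ AgreeOff x w s t := by
  refine forall_congr' fun z => forall_congr' fun _ => ?_
  by_cases hz : z = y
  · subst hz
    simp [h]
  · rw [Function.update_of_ne hz, Function.update_of_ne hz]

theorem siteAvg_eq_self {A : ChainOp d L} [NeZero d] {y : ZMod (2 * L)}
    (h1 : ∀ s t, s y ≠ t y → A s t = 0)
    (h2 : ∀ s t i, s y = t y → A (Function.update s y i) (Function.update t y i) = A s t) :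
    siteAvg y A = A := by
  ext s t
  rw [siteAvg_apply]
  split_ifs with h
  · rw [Finset.sum_congr rfl fun i _ => h2 s t i h]
    have : (d : ℂ) ≠ 0 := NeZero.ne _
    simp [this]
  · exact (h1 s t h).symm

theorem siteAvg_placeAt_off [NeZero d] {x y : ZMod (2 * L)} (hy : OffArc x w y)
    (a : LocalOp d w) : siteAvg y (placeAt x a) = placeAt x a := by
  refine siteAvg_eq_self (fun s t h => placeAt_of_not_agree _ fun h' => h (h' y hy))
    fun s t i h => ?_
  exact placeAt_congr (by rw [restrictArc_update_off hy, restrictArc_update_off hy])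
    (agreeOff_update_same h i)

theorem siteAvg_placeAt_traceless (hw : w ≤ 2 * L) (x : ZMod (2 * L)) {a : LocalOp d w}
    {k : Fin w} (h : IsTracelessAt a k) :
    siteAvg (x + ((k : ℕ) : ZMod (2 * L))) (placeAt x a) = 0 := by
  have hk : ¬ OffArc x w (x + ((k : ℕ) : ZMod (2 * L))) := fun h => h k rfl
  ext s t
  rw [siteAvg_apply]
  split_ifs with hst
  · refine mul_eq_zero_of_right _ ?_
    by_cases h' : AgreeOff x w s t
    · rw [← h (restrictArc x w s) (restrictArc x w t)]
      refine Finset.sum_congr rfl fun i _ => ?_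
      rw [placeAt_of_agree _ ((agreeOff_update_on hk _ _ _ _).2 h'), restrictArc_update_on hw,
        restrictArc_update_on hw]
    · exact Finset.sum_eq_zero fun i _ =>
        placeAt_of_not_agree _ (mt (agreeOff_update_on hk _ _ _ _).1 h')
  · rfl

/-- Partial traces of local operators become site averages on the chain; the two factors `d⁻¹` from
two such steps are the prefactor `1 / d ^ 2` of the transfer maps. -/
theorem siteAvg_placeAt_first (hw : w + 1 ≤ 2 * L) (x : ZMod (2 * L)) (a : LocalOp d (w + 1)) :
    siteAvg x (placeAt x a) = (d : ℂ)⁻¹ • placeAt (x + 1) (traceFirst a) := by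
  have hk : ¬ OffArc x (w + 1) x := fun h => h 0 (by simp)
  have hx : OffArc (x + 1) w x := by
    have := offArc_sub (x + 1) (k := 1) (w := w) le_rfl hw
    rwa [Nat.cast_one, add_sub_cancel_right] at this
  have hr : ∀ (s : ZMod (2 * L) → Fin d) i, restrictArc x (w + 1) (Function.update s x i) =
      Fin.cons i (restrictArc (x + 1) w s) := by
    intro s i
    have := restrictArc_update_on hw x 0 s i
    simp only [Fin.val_zero, Nat.cast_zero, add_zero] at this
    rw [this]
    funext k
    refine Fin.cases ?_ (fun k => ?_) k
    · simp
    · simp [restrictArc, add_left_comm, add_comm]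
  ext s t
  rw [siteAvg_apply, Matrix.smul_apply, smul_eq_mul]
  split_ifs with hst
  · congr 1
    by_cases h : AgreeOff (x + 1) w s t
    · have h' : AgreeOff x (w + 1) s t := fun y hy => h y (offArc_succ_iff.1 hy).2
      rw [placeAt_of_agree _ h, traceFirst]
      refine Finset.sum_congr rfl fun i _ => ?_
      rw [placeAt_of_agree _ ((agreeOff_update_on hk _ _ _ _).2 h'), hr, hr]
    · rw [placeAt_of_not_agree _ h]
      refine Finset.sum_eq_zero fun i _ => placeAt_of_not_agree _ fun h' => h fun y hy => ?_
      rw [agreeOff_update_on hk] at h'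
      by_cases hyx : y = x
      · rw [hyx, hst]
      · exact h' y (offArc_succ_iff.2 ⟨hyx, hy⟩)
  · rw [placeAt_of_not_agree _ fun h => hst (h x hx), mul_zero]

theorem siteAvg_placeAt_last (hw : w + 1 ≤ 2 * L) (x : ZMod (2 * L)) (a : LocalOp d (w + 1)) :
    siteAvg (x + (w : ZMod (2 * L))) (placeAt x a) = (d : ℂ)⁻¹ • placeAt x (traceLast a) := by
  have hk : ¬ OffArc x (w + 1) (x + (w : ZMod (2 * L))) := fun h => h (Fin.last w) (by simp)
  have hx : OffArc x w (x + (w : ZMod (2 * L))) := offArc_add x le_rfl (by omega)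
  have hr : ∀ (s : ZMod (2 * L) → Fin d) i,
      restrictArc x (w + 1) (Function.update s (x + (w : ZMod (2 * L))) i) =
      Fin.snoc (restrictArc x w s) i := by
    intro s i
    have := restrictArc_update_on hw x (Fin.last w) s i
    simp only [Fin.val_last] at this
    rw [this]
    funext k
    refine Fin.lastCases ?_ (fun k => ?_) k
    · simp
    · simp [restrictArc]
  ext s t
  rw [siteAvg_apply, Matrix.smul_apply, smul_eq_mul]
  split_ifs with hst
  · congr 1
    by_cases h : AgreeOff x w s t
    · have h' : AgreeOff x (w + 1) s t := fun y hy => h y (offArc_succ_iff_last.1 hy).1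
      rw [placeAt_of_agree _ h, traceLast]
      refine Finset.sum_congr rfl fun i _ => ?_
      rw [placeAt_of_agree _ ((agreeOff_update_on hk _ _ _ _).2 h'), hr, hr]
    · rw [placeAt_of_not_agree _ h]
      refine Finset.sum_eq_zero fun i _ => placeAt_of_not_agree _ fun h' => h fun y hy => ?_
      rw [agreeOff_update_on hk] at h'
      by_cases hyx : y = x + (w : ZMod (2 * L))
      · rw [hyx, hst]
      · exact h' y (offArc_succ_iff_last.2 ⟨hy, hyx⟩)
  · rw [placeAt_of_not_agree _ fun h => hst (h _ hx), mul_zero]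

variable [NeZero L]

/-- The matrix unit `|i⟩⟨j|` at the site `y`. -/
def siteUnit (y : ZMod (2 * L)) (i j : Fin d) : ChainOp d L :=
  fun s t => if s y = i ∧ t = Function.update s y j then 1 else 0

theorem siteUnit_mul_apply (y : ZMod (2 * L)) (i j : Fin d) (A : ChainOp d L)
    (s t : ZMod (2 * L) → Fin d) :
    (siteUnit y i j * A) s t = if s y = i then A (Function.update s y j) t else 0 := by
  rw [Matrix.mul_apply, Finset.sum_eq_single (Function.update s y j)]
  · simp [siteUnit]
  · intro u _ hu
    simp [siteUnit, hu]
  · simp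

theorem mul_siteUnit_apply (y : ZMod (2 * L)) (i j : Fin d) (A : ChainOp d L)
    (s t : ZMod (2 * L) → Fin d) :
    (A * siteUnit y i j) s t = if t y = j then A s (Function.update t y i) else 0 := by
  rw [Matrix.mul_apply, Finset.sum_eq_single (Function.update t y i)]
  · by_cases h : t y = j
    · subst h
      simp [siteUnit]
    · have : t ≠ Function.update t y j := fun h' => h (by rw [h']; simp)
      simp [siteUnit, h, this]
  · intro u _ hu
    have : ¬ (u y = i ∧ t = Function.update u y j) := by
      rintro ⟨rfl, rfl⟩
      exact hu (by simp)
    simp [siteUnit, this]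
  · simp

theorem siteUnit_conjTranspose (y : ZMod (2 * L)) (i j : Fin d) :
    (siteUnit y i j : ChainOp d L).conjTranspose = siteUnit y j i := by
  ext s t
  have : (t y = i ∧ s = Function.update t y j) ↔ (s y = j ∧ t = Function.update s y i) := by
    constructor <;> rintro ⟨rfl, rfl⟩ <;> simp
  simp [siteUnit, Matrix.conjTranspose_apply, this]

/-- The Kraus form of the average: it reduces both `siteAvg_conj` and the self-adjointness
`hs_siteAvg` to algebra with matrix units. -/
theorem siteAvg_eq_sum (y : ZMod (2 * L)) (A : ChainOp d L) :
    siteAvg y A = (d : ℂ)⁻¹ • ∑ i, ∑ j, siteUnit y i j * A * siteUnit y j i := by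
  ext s t
  have hu : ∀ i j, (siteUnit y i j * A * siteUnit y j i) s t = if t y = i then
      (if s y = i then A (Function.update s y j) (Function.update t y j) else 0) else 0 := by
    intro i j
    rw [mul_siteUnit_apply, siteUnit_mul_apply]
  rw [siteAvg_apply, Matrix.smul_apply, Matrix.sum_apply, smul_eq_mul]
  simp only [Matrix.sum_apply]
  by_cases h : s y = t y
  · rw [if_pos h]
    refine congrArg _ (Eq.symm ?_)
    rw [Finset.sum_eq_single (s y)]
    · refine Finset.sum_congr rfl fun j _ => ?_
      rw [hu, if_pos h.symm, if_pos rfl]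
    · intro i _ hi
      refine Finset.sum_eq_zero fun j _ => ?_
      rw [hu, if_neg hi.symm, ite_self]
    · simp
  · rw [if_neg h]
    refine (mul_eq_zero_of_right _ (Finset.sum_eq_zero fun i _ =>
      Finset.sum_eq_zero fun j _ => ?_)).symm
    rw [hu]
    split_ifs with h1 h2
    · exact absurd (h2.trans h1.symm) h
    · rfl
    · rfl

theorem siteAvg_conj {W : ChainOp d L} {y : ZMod (2 * L)}
    (hW : ∀ i j, Commute W (siteUnit y i j)) (A : ChainOp d L) :
    siteAvg y (W * A * W.conjTranspose) = W * siteAvg y A * W.conjTranspose := by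
  have h2 : ∀ i j, W.conjTranspose * siteUnit y i j = siteUnit y i j * W.conjTranspose := by
    intro i j
    have := congrArg Matrix.conjTranspose (hW j i).eq
    simpa [Matrix.conjTranspose_mul, siteUnit_conjTranspose] using this.symm
  rw [siteAvg_eq_sum, siteAvg_eq_sum, Matrix.mul_smul, Matrix.smul_mul]
  simp only [Finset.mul_sum, Finset.sum_mul]
  refine congrArg _ (Finset.sum_congr rfl fun i _ => Finset.sum_congr rfl fun j _ => ?_)
  calc siteUnit y i j * (W * A * W.conjTranspose) * siteUnit y j i
      = (siteUnit y i j * W) * A * (W.conjTranspose * siteUnit y j i) := by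
        simp only [Matrix.mul_assoc]
    _ = (W * siteUnit y i j) * A * (siteUnit y j i * W.conjTranspose) := by
        rw [h2, (hW i j).eq]
    _ = W * (siteUnit y i j * A * siteUnit y j i) * W.conjTranspose := by
        simp only [Matrix.mul_assoc]

/-- The Hilbert–Schmidt inner product. -/
noncomputable def hs (A B : ChainOp d L) : ℂ := (A.conjTranspose * B).trace

theorem hs_sub_right (A B C : ChainOp d L) : hs A (B - C) = hs A B - hs A C := by
  simp [hs, Matrix.mul_sub]

theorem hs_sub_left (A B C : ChainOp d L) : hs (A - B) C = hs A C - hs B C := by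
  simp [hs, Matrix.sub_mul]

theorem hs_smul_right (c : ℂ) (A B : ChainOp d L) : hs A (c • B) = c * hs A B := by
  simp [hs]

theorem hs_smul_left (c : ℂ) (A B : ChainOp d L) : hs (c • A) B = star c * hs A B := by
  simp [hs]

theorem hs_sum_right {ι : Type*} (S : Finset ι) (A : ChainOp d L) (f : ι → ChainOp d L) :
    hs A (∑ i ∈ S, f i) = ∑ i ∈ S, hs A (f i) := by
  simp [hs, Finset.mul_sum, Matrix.trace_sum]

@[simp] theorem hs_zero_right (A : ChainOp d L) : hs A 0 = 0 := by
  simp [hs]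

@[simp] theorem hs_zero_left (A : ChainOp d L) : hs 0 A = 0 := by
  simp [hs]

theorem hs_star (A B : ChainOp d L) : star (hs A B) = hs B A := by
  rw [hs, hs, ← Matrix.trace_conjTranspose, Matrix.conjTranspose_mul,
    Matrix.conjTranspose_conjTranspose]

open scoped ComplexOrder in
theorem hs_self_nonneg (A : ChainOp d L) : 0 ≤ hs A A :=
  (Matrix.posSemidef_conjTranspose_mul_self A).trace_nonneg

open scoped ComplexOrder in
theorem hs_self_eq_zero {A : ChainOp d L} : hs A A = 0 ↔ A = 0 :=
  Matrix.trace_conjTranspose_mul_self_eq_zero_iff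

theorem hs_conj (W A B : ChainOp d L) :
    hs B (W * A * W.conjTranspose) = hs (W.conjTranspose * B * W) A := by
  simp only [hs, Matrix.conjTranspose_mul, Matrix.conjTranspose_conjTranspose]
  rw [← Matrix.mul_assoc, Matrix.trace_mul_comm]
  simp only [Matrix.mul_assoc]

theorem hs_siteAvg (y : ZMod (2 * L)) (A B : ChainOp d L) :
    hs (siteAvg y A) B = hs A (siteAvg y B) := by
  have key : ∀ i j, hs A (siteUnit y i j * B * siteUnit y j i) =
      hs (siteUnit y j i * A * siteUnit y i j) B := by
    intro i j
    have := hs_conj (siteUnit y i j) B A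
    rwa [siteUnit_conjTranspose] at this
  rw [siteAvg_eq_sum, siteAvg_eq_sum, hs_smul_left, hs_smul_right]
  simp only [hs_sum_right, key]
  rw [Finset.sum_comm]
  simp only [hs, Matrix.conjTranspose_sum, Finset.sum_mul, Matrix.trace_sum]
  simp

end SiteAverage

theorem sum_reverse {ι κ τ M : Type*} [Fintype ι] [Fintype κ] [Fintype τ] [AddCommMonoid M]
    (f : ι → κ → τ → M) : ∑ i, ∑ j, ∑ k, f i j k = ∑ k, ∑ j, ∑ i, f i j k := by
  rw [Finset.sum_comm, Finset.sum_congr rfl fun j _ => Finset.sum_comm, Finset.sum_comm]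

/-! ### Dual-unitary gates and partial traces on two sites. -/

section GateAverage

variable {d : ℕ}

/-- The normalized partial trace over the left qudit, tensored with the identity. -/
noncomputable def gateAvgLeft (X : Gate d) : Gate d :=
  Matrix.of fun p q => if p.1 = q.1 then (d : ℂ)⁻¹ * ∑ i, X (i, p.2) (i, q.2) else 0

/-- The normalized partial trace over the right qudit, tensored with the identity. -/
noncomputable def gateAvgRight (X : Gate d) : Gate d :=
  Matrix.of fun p q => if p.2 = q.2 then (d : ℂ)⁻¹ * ∑ i, X (p.1, i) (q.1, i) else 0

theorem gateAvgLeft_apply (X : Gate d) (i j k l : Fin d) : gateAvgLeft X (i, j) (k, l) =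
    if i = k then (d : ℂ)⁻¹ * ∑ m, X (m, j) (m, l) else 0 := rfl

theorem gateAvgRight_apply (X : Gate d) (i j k l : Fin d) : gateAvgRight X (i, j) (k, l) =
    if j = l then (d : ℂ)⁻¹ * ∑ m, X (i, m) (k, m) else 0 := rfl

theorem gateAvgLeft_gateAvgRight (X : Gate d) :
    gateAvgLeft (gateAvgRight X) = ((d : ℂ)⁻¹ * (d : ℂ)⁻¹ * X.trace) • 1 := by
  ext ⟨i, j⟩ ⟨k, l⟩
  simp only [gateAvgLeft_apply, gateAvgRight_apply, Matrix.smul_apply, Matrix.one_apply,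
    Prod.mk.injEq, smul_eq_mul, Matrix.trace, Matrix.diag_apply, Fintype.sum_prod_type]
  by_cases h1 : i = k <;> by_cases h2 : j = l <;> simp [h1, h2, Finset.mul_sum, mul_assoc]

theorem gate_conj_gateAvg {G : Gate d} (hG : G ∈ Matrix.unitaryGroup (Fin d × Fin d) ℂ)
    (X : Gate d) : G * gateAvgLeft (gateAvgRight X) * G.conjTranspose =
      gateAvgLeft (gateAvgRight X) := by
  have h : G * G.conjTranspose = 1 := Matrix.mem_unitaryGroup_iff.1 hG
  rw [gateAvgLeft_gateAvgRight, Matrix.mul_smul, Matrix.smul_mul, mul_one, h]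

/-- Unitarity of the dual gate read in the original indices: contracting `G` with its conjugate over
both right legs leaves the identity on the left legs. `dual_sum_rows` is the mirror image. -/
theorem dual_sum_columns {G : Gate d} (hG : IsDualUnitary G) (i k i' k' : Fin d) :
    ∑ l, ∑ b, G (i, b) (k, l) * star (G (i', b) (k', l)) = if i = i' ∧ k = k' then 1 else 0 := by
  have h : (dualGate G).conjTranspose * dualGate G = 1 := Matrix.mem_unitaryGroup_iff'.1 hG.2
  have := congrFun (congrFun h (k', i')) (k, i)
  rw [Matrix.mul_apply, Fintype.sum_prod_type, Matrix.one_apply] at this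
  simp only [Matrix.conjTranspose_apply, dualGate, Prod.mk.injEq] at this
  have h3 : (k' = k ∧ i' = i) ↔ (i = i' ∧ k = k') := by tauto
  simp only [h3] at this
  rw [← this]
  exact Finset.sum_congr rfl fun l _ => Finset.sum_congr rfl fun b _ => mul_comm _ _

theorem dual_sum_rows {G : Gate d} (hG : IsDualUnitary G) (b l b' l' : Fin d) :
    ∑ k, ∑ i, G (i, b) (k, l) * star (G (i, b') (k, l')) = if b = b' ∧ l = l' then 1 else 0 := by
  have h : dualGate G * (dualGate G).conjTranspose = 1 := Matrix.mem_unitaryGroup_iff.1 hG.2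
  have := congrFun (congrFun h (l, b)) (l', b')
  rw [Matrix.mul_apply, Fintype.sum_prod_type, Matrix.one_apply] at this
  simp only [Matrix.conjTranspose_apply, dualGate, Prod.mk.injEq] at this
  have h3 : (l = l' ∧ b = b') ↔ (b = b' ∧ l = l') := by tauto
  simp only [h3] at this
  exact this

/-- The averaged input contracts the incoming right legs of `G` and its conjugate, and the outer
average contracts the outgoing ones. By `dual_sum_columns` what remains of `X` is its full trace. -/
theorem gateAvgRight_conj {G : Gate d} (hG : IsDualUnitary G) (X : Gate d) :
    gateAvgRight (G * gateAvgRight X * G.conjTranspose) = gateAvgLeft (gateAvgRight X) := by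
  have hz : ∀ p k' l', (G * gateAvgRight X) p (k', l') =
      ∑ k, G p (k, l') * ((d : ℂ)⁻¹ * ∑ m, X (k, m) (k', m)) := by
    intro p k' l'
    rw [Matrix.mul_apply, Fintype.sum_prod_type]
    simp [gateAvgRight_apply]
  have key : ∀ i i', ∑ b, (G * gateAvgRight X * G.conjTranspose) (i, b) (i', b) =
      if i = i' then ∑ k, ((d : ℂ)⁻¹ * ∑ m, X (k, m) (k, m)) else 0 := by
    intro i i'
    calc ∑ b, (G * gateAvgRight X * G.conjTranspose) (i, b) (i', b)
        = ∑ b, ∑ k', ∑ l, ∑ k, ((d : ℂ)⁻¹ * ∑ m, X (k, m) (k', m)) *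
            (G (i, b) (k, l) * star (G (i', b) (k', l))) := by
          refine Finset.sum_congr rfl fun b _ => ?_
          rw [Matrix.mul_apply, Fintype.sum_prod_type]
          refine Finset.sum_congr rfl fun k' _ => Finset.sum_congr rfl fun l _ => ?_
          rw [hz, Finset.sum_mul, Matrix.conjTranspose_apply]
          exact Finset.sum_congr rfl fun k _ => by ring
      _ = ∑ k', ∑ k, ((d : ℂ)⁻¹ * ∑ m, X (k, m) (k', m)) *
            ∑ l, ∑ b, (G (i, b) (k, l) * star (G (i', b) (k', l))) := by
          rw [Finset.sum_comm]
          refine Finset.sum_congr rfl fun k' _ => ?_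
          rw [sum_reverse]
          simp only [Finset.mul_sum _ (fun _ => ∑ _, _), Finset.mul_sum _ (fun _ => _ * star _)]
      _ = _ := by
          simp only [dual_sum_columns hG]
          by_cases h : i = i' <;> simp [h]
  ext ⟨i, j⟩ ⟨k, l⟩
  rw [gateAvgRight_apply, gateAvgLeft_apply, key]
  simp only [gateAvgRight_apply]
  by_cases h1 : i = k <;> by_cases h2 : j = l <;> simp [h1, h2]

theorem gateAvgLeft_conj {G : Gate d} (hG : IsDualUnitary G) (X : Gate d) :
    gateAvgLeft (G * gateAvgLeft X * G.conjTranspose) = gateAvgLeft (gateAvgRight X) := by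
  have hz : ∀ p k' l', (G * gateAvgLeft X) p (k', l') =
      ∑ l, G p (k', l) * ((d : ℂ)⁻¹ * ∑ m, X (m, l) (m, l')) := by
    intro p k' l'
    rw [Matrix.mul_apply, Fintype.sum_prod_type, Finset.sum_comm]
    simp [gateAvgLeft_apply]
  have key : ∀ b b', ∑ i, (G * gateAvgLeft X * G.conjTranspose) (i, b) (i, b') =
      if b = b' then ∑ l, ((d : ℂ)⁻¹ * ∑ m, X (m, l) (m, l)) else 0 := by
    intro b b'
    calc ∑ i, (G * gateAvgLeft X * G.conjTranspose) (i, b) (i, b')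
        = ∑ i, ∑ l', ∑ k, ∑ l, ((d : ℂ)⁻¹ * ∑ m, X (m, l) (m, l')) *
            (G (i, b) (k, l) * star (G (i, b') (k, l'))) := by
          refine Finset.sum_congr rfl fun i _ => ?_
          rw [Matrix.mul_apply, Fintype.sum_prod_type, Finset.sum_comm]
          refine Finset.sum_congr rfl fun l' _ => Finset.sum_congr rfl fun k _ => ?_
          rw [hz, Finset.sum_mul, Matrix.conjTranspose_apply]
          exact Finset.sum_congr rfl fun l _ => by ring
      _ = ∑ l', ∑ l, ((d : ℂ)⁻¹ * ∑ m, X (m, l) (m, l')) *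
            ∑ k, ∑ i, (G (i, b) (k, l) * star (G (i, b') (k, l'))) := by
          rw [Finset.sum_comm]
          refine Finset.sum_congr rfl fun l' _ => ?_
          rw [sum_reverse]
          simp only [Finset.mul_sum _ (fun _ => ∑ _, _), Finset.mul_sum _ (fun _ => _ * star _)]
      _ = _ := by
          simp only [dual_sum_rows hG]
          by_cases h : b = b' <;> simp [h]
  ext ⟨i, j⟩ ⟨k, l⟩
  rw [gateAvgLeft_apply, gateAvgLeft_apply, key]
  simp only [gateAvgRight_apply]
  by_cases h1 : i = k <;> by_cases h2 : j = l <;> simp [h1, h2]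
  simp only [← Finset.mul_sum]
  rw [Finset.sum_comm]
  exact Or.inl rfl

/-- Makes every light-cone statement available for the inverse evolution too. -/
theorem IsDualUnitary.conjTranspose {G : Gate d} (hG : IsDualUnitary G) :
    IsDualUnitary G.conjTranspose := by
  refine ⟨Matrix.mem_unitaryGroup_iff.2 ?_, Matrix.mem_unitaryGroup_iff.2 ?_⟩
  · rw [Matrix.star_eq_conjTranspose, Matrix.conjTranspose_conjTranspose]
    exact Matrix.mem_unitaryGroup_iff'.1 hG.1
  · ext ⟨i, j⟩ ⟨k, l⟩
    have := congrArg star (dual_sum_rows hG i j k l)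
    rw [Matrix.mul_apply, Fintype.sum_prod_type]
    simp only [Matrix.star_eq_conjTranspose, Matrix.conjTranspose_apply, dualGate, Matrix.one_apply,
      Prod.mk.injEq]
    simp only [star_sum, star_mul', star_star] at this
    rw [apply_ite star, star_one, star_zero] at this
    rw [← this]
    simp only [star_star]
    exact Finset.sum_comm

end GateAverage

/-! ### Layers of gates as tensor products. -/

section Layer

variable {d L : ℕ}

/-- The pair of values of a configuration at the sites `2 j + r` and `2 j + r + 1`. -/
def pairAt (r : ZMod (2 * L)) (s : ZMod (2 * L) → Fin d) (j : Fin L) : Fin d × Fin d :=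
  (s (2 * ((j : ℕ) : ZMod (2 * L)) + r), s (2 * ((j : ℕ) : ZMod (2 * L)) + r + 1))

/-- The tensor product of the gates `g j` acting on the pairs of sites `(2 j + r, 2 j + r + 1)`. -/
def layerFam (r : ZMod (2 * L)) (g : Fin L → Gate d) : ChainOp d L :=
  Matrix.of fun s t => ∏ j, g j (pairAt r s j) (pairAt r t j)

theorem layerFam_apply (r : ZMod (2 * L)) (g : Fin L → Gate d) (s t : ZMod (2 * L) → Fin d) :
    layerFam r g s t = ∏ j, g j (pairAt r s j) (pairAt r t j) := rfl

theorem chainLayer_eq_layerFam (G : Gate d) (r : ZMod (2 * L)) :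
    chainLayer L G r = layerFam r fun _ => G := rfl

theorem layerFam_conjTranspose (r : ZMod (2 * L)) (g : Fin L → Gate d) :
    (layerFam r g).conjTranspose = layerFam r fun j => (g j).conjTranspose := by
  ext s t
  simp [layerFam_apply, Matrix.conjTranspose_apply]

theorem chainLayer_conjTranspose (G : Gate d) (r : ZMod (2 * L)) :
    (chainLayer L G r).conjTranspose = chainLayer L G.conjTranspose r :=
  layerFam_conjTranspose r _

variable [NeZero L]

/-- The sites of the chain, as pairs `2 j + r + b` with `b = 0, 1`. -/
noncomputable def sitePairs (r : ZMod (2 * L)) : Fin L × Fin 2 ≃ ZMod (2 * L) :=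
  Equiv.ofBijective (fun p => 2 * ((p.1 : ℕ) : ZMod (2 * L)) + r + ((p.2 : ℕ) : ZMod (2 * L))) <| by
    rw [Fintype.bijective_iff_injective_and_card]
    refine ⟨?_, by simp [ZMod.card, mul_comm]⟩
    rintro ⟨j, b⟩ ⟨k, c⟩ h
    have h' : ((2 * (j : ℕ) + (b : ℕ) : ℕ) : ZMod (2 * L)) = ((2 * (k : ℕ) + (c : ℕ) : ℕ) :) := by
      push_cast
      linear_combination h
    have := zmod_natCast_inj (by omega) (by omega) h'
    simp only [Prod.mk.injEq, Fin.ext_iff]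
    omega

theorem sitePairs_apply (r : ZMod (2 * L)) (j : Fin L) (b : Fin 2) :
    sitePairs r (j, b) = 2 * ((j : ℕ) : ZMod (2 * L)) + r + ((b : ℕ) : ZMod (2 * L)) := rfl

/-- Configurations of the chain as families of configurations of pairs of sites. -/
noncomputable def pairConfig (r : ZMod (2 * L)) :
    (ZMod (2 * L) → Fin d) ≃ (Fin L → Fin d × Fin d) :=
  Equiv.ofBijective (pairAt r) <| by
    constructor
    · intro s t h
      funext y
      obtain ⟨⟨j, b⟩, rfl⟩ := (sitePairs r).surjective y
      have := congrFun h j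
      simp only [pairAt, Prod.mk.injEq] at this
      fin_cases b
      · simpa [sitePairs_apply] using this.1
      · simpa [sitePairs_apply] using this.2
    · intro p
      refine ⟨fun y => if ((sitePairs r).symm y).2 = 0 then (p ((sitePairs r).symm y).1).1 else
        (p ((sitePairs r).symm y).1).2, ?_⟩
      funext j
      have h0 : 2 * ((j : ℕ) : ZMod (2 * L)) + r = sitePairs r (j, 0) := by simp [sitePairs_apply]
      have h1 : 2 * ((j : ℕ) : ZMod (2 * L)) + r + 1 = sitePairs r (j, 1) := by
        simp [sitePairs_apply]
      simp only [pairAt]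
      rw [h1, h0]
      simp

theorem layerFam_mul (r : ZMod (2 * L)) (g h : Fin L → Gate d) :
    layerFam r g * layerFam r h = layerFam r fun j => g j * h j := by
  ext s t
  rw [Matrix.mul_apply, layerFam_apply]
  simp only [Matrix.mul_apply, layerFam_apply, ← Finset.prod_mul_distrib]
  rw [Finset.prod_univ_sum, Fintype.piFinset_univ]
  exact Fintype.sum_equiv (pairConfig r) _ _ fun u => rfl

theorem layerFam_one (r : ZMod (2 * L)) : layerFam r (fun _ => (1 : Gate d)) = 1 := by
  ext s t
  by_cases h : s = t
  · subst h
    rw [Matrix.one_apply_eq]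
    have h1 : ∀ p : Fin d × Fin d, (1 : Gate d) p p = 1 := fun p => Matrix.one_apply_eq p
    rw [layerFam_apply]
    exact Finset.prod_eq_one fun j _ => h1 (pairAt r s j)
  · have : pairAt r s ≠ pairAt r t := fun h' => h ((pairConfig r).injective h')
    obtain ⟨j, hj⟩ := Function.ne_iff.1 this
    rw [Matrix.one_apply_ne h]
    exact Finset.prod_eq_zero (Finset.mem_univ j) (Matrix.one_apply_ne hj)

theorem layerFam_mul_conjTranspose (r : ZMod (2 * L)) {g : Fin L → Gate d}
    (hg : ∀ j, g j ∈ Matrix.unitaryGroup (Fin d × Fin d) ℂ) :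
    layerFam r g * (layerFam r g).conjTranspose = 1 := by
  rw [layerFam_conjTranspose, layerFam_mul, ← layerFam_one r]
  exact congrArg _ (funext fun j => Matrix.mem_unitaryGroup_iff.1 (hg j))

theorem chainLayer_add_two (G : Gate d) (r : ZMod (2 * L)) :
    chainLayer L G (r + 2) = chainLayer L G r := by
  ext s t
  obtain ⟨m, rfl⟩ := Nat.exists_eq_succ_of_ne_zero (NeZero.ne L)
  have key : ∀ F : ZMod (2 * (m + 1)) → ℂ, ∏ j : Fin (m + 1), F (2 * ((j : ℕ) : ZMod _) + (r + 2)) =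
      ∏ j : Fin (m + 1), F (2 * ((j : ℕ) : ZMod _) + r) := by
    intro F
    -- A shift by two sites permutes the pairs cyclically: the last factor on the left is the first
    -- on the right, because `2 * (m + 1) = 0` on the ring.
    rw [Fin.prod_univ_castSucc, Fin.prod_univ_succ, mul_comm]
    have h := two_mul_natCast_self (m + 1)
    push_cast at h
    congr 1
    · congr 1
      simp only [Fin.val_last, Fin.val_zero, Nat.cast_zero]
      linear_combination h
    · refine Finset.prod_congr rfl fun j _ => ?_
      congr 1
      simp only [Fin.val_castSucc, Fin.val_succ]
      push_cast
      ring
  exact key fun y => G (s y, s (y + 1)) (t y, t (y + 1))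

theorem chainLayer_add_two_mul (G : Gate d) (r : ZMod (2 * L)) (k : ℕ) :
    chainLayer L G (r + 2 * (k : ZMod (2 * L))) = chainLayer L G r := by
  induction k with
  | zero => simp
  | succ k ih =>
    rw [← ih, ← chainLayer_add_two G (r + 2 * (k : ZMod (2 * L)))]
    congr 1
    push_cast
    ring

theorem chainLayer_of_even (G : Gate d) {x : ZMod (2 * L)} (hx : Even x) :
    chainLayer L G x = chainLayer L G 0 := by
  obtain ⟨k, rfl⟩ := hx
  have := chainLayer_add_two_mul (L := L) G 0 k.val
  rwa [ZMod.natCast_zmod_val, zero_add, two_mul] at this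

theorem chainLayer_of_odd (G : Gate d) {x : ZMod (2 * L)} (hx : Odd x) :
    chainLayer L G x = chainLayer L G 1 := by
  obtain ⟨k, rfl⟩ := hx
  have := chainLayer_add_two_mul (L := L) G 1 k.val
  rwa [ZMod.natCast_zmod_val, add_comm] at this

end Layer

/-! ### Splitting a layer into the gates on an arc and the rest. -/

section RowLayer

variable {d L : ℕ}

theorem pairAt_of_agreeOff {x : ZMod (2 * L)} {n : ℕ} {s t : ZMod (2 * L) → Fin d}
    (h : AgreeOff x n s t) {j : Fin L} (hj : n ≤ 2 * (j : ℕ)) : pairAt x s j = pairAt x t j := by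
  have h0 := h _ (offArc_add x hj (by omega))
  have h1 := h _ (offArc_add x (k := 2 * (j : ℕ) + 1) (by omega) (by omega))
  push_cast at h0 h1
  rw [add_comm x] at h0
  rw [← add_assoc, add_comm x] at h1
  rw [pairAt, pairAt, h0, h1]

theorem pairAt_of_restrictArc {x : ZMod (2 * L)} {n : ℕ} {s t : ZMod (2 * L) → Fin d}
    (h : restrictArc x n s = restrictArc x n t) {j : Fin L} (hj : 2 * (j : ℕ) + 1 < n) :
    pairAt x s j = pairAt x t j := by
  have h0 := congrFun h ⟨2 * (j : ℕ), by omega⟩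
  have h1 := congrFun h ⟨2 * (j : ℕ) + 1, by omega⟩
  simp only [restrictArc] at h0 h1
  push_cast at h0 h1
  rw [add_comm x] at h0
  rw [← add_assoc, add_comm x] at h1
  rw [pairAt, pairAt, h0, h1]

theorem restrictArc_of_pairAt {x : ZMod (2 * L)} {m : ℕ} (hm : m ≤ L)
    {s t : ZMod (2 * L) → Fin d}
    (h : ∀ j : Fin L, (j : ℕ) < m → pairAt x s j = pairAt x t j) :
    restrictArc x (2 * m) s = restrictArc x (2 * m) t := by
  funext i
  have := h ⟨(i : ℕ) / 2, by omega⟩ (by simp only; omega)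
  simp only [pairAt, Prod.mk.injEq] at this
  simp only [restrictArc]
  rcases Nat.even_or_odd' (i : ℕ) with ⟨k, hk | hk⟩
  · have hk2 : (i : ℕ) / 2 = k := by omega
    rw [hk2] at this
    rw [hk]
    push_cast
    rw [add_comm]
    exact this.1
  · have hk2 : (i : ℕ) / 2 = k := by omega
    rw [hk2] at this
    rw [hk]
    push_cast
    rw [add_comm, add_right_comm]
    exact this.2

/-- The part of the layer that acts on the arc of `2 m` sites that starts at `x`. -/
noncomputable def rowPart (x : ZMod (2 * L)) (m : ℕ) (G : Gate d) : ChainOp d L :=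
  layerFam x fun j => if (j : ℕ) < m then G else 1

/-- The part of the layer that acts off the arc of `2 m` sites that starts at `x`. -/
noncomputable def restPart (x : ZMod (2 * L)) (m : ℕ) (G : Gate d) : ChainOp d L :=
  layerFam x fun j => if (j : ℕ) < m then 1 else G

theorem restPart_eq_zero {m : ℕ} (hm : m ≤ L) {x : ZMod (2 * L)} {G : Gate d}
    {s t : ZMod (2 * L) → Fin d} (h : restrictArc x (2 * m) s ≠ restrictArc x (2 * m) t) :
    restPart x m G s t = 0 := by
  have : ¬ ∀ j : Fin L, (j : ℕ) < m → pairAt x s j = pairAt x t j :=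
    fun h' => h (restrictArc_of_pairAt hm h')
  push Not at this
  obtain ⟨j, hj, hne⟩ := this
  rw [restPart, layerFam_apply]
  refine Finset.prod_eq_zero (Finset.mem_univ j) ?_
  rw [if_pos hj]
  exact Matrix.one_apply_ne hne

theorem restPart_congr {m : ℕ} {x : ZMod (2 * L)} {G : Gate d}
    {s t s' t' : ZMod (2 * L) → Fin d} (h : restrictArc x (2 * m) s = restrictArc x (2 * m) t)
    (h' : restrictArc x (2 * m) s' = restrictArc x (2 * m) t')
    (hs : AgreeOff x (2 * m) s s') (ht : AgreeOff x (2 * m) t t') :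
    restPart x m G s t = restPart x m G s' t' := by
  have h1 : ∀ p q : Fin d × Fin d, (1 : Gate d) p p = (1 : Gate d) q q := fun p q =>
    (Matrix.one_apply_eq p).trans (Matrix.one_apply_eq q).symm
  rw [restPart, layerFam_apply, layerFam_apply]
  refine Finset.prod_congr rfl fun j _ => ?_
  by_cases hj : (j : ℕ) < m
  · rw [if_pos hj, pairAt_of_restrictArc h (by omega), pairAt_of_restrictArc h' (by omega)]
    exact h1 _ _
  · rw [if_neg hj, pairAt_of_agreeOff hs (by omega), pairAt_of_agreeOff ht (by omega)]

variable [NeZero L]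

theorem chainLayer_eq_mul (x : ZMod (2 * L)) (m : ℕ) (G : Gate d) :
    chainLayer L G x = rowPart x m G * restPart x m G := by
  rw [rowPart, restPart, layerFam_mul, chainLayer_eq_layerFam]
  congr 1
  funext j
  split_ifs <;> simp

theorem restPart_mul_conjTranspose (x : ZMod (2 * L)) (m : ℕ) {G : Gate d}
    (hG : G ∈ Matrix.unitaryGroup (Fin d × Fin d) ℂ) :
    restPart x m G * (restPart x m G).conjTranspose = 1 := by
  refine layerFam_mul_conjTranspose _ fun j => ?_
  split_ifs
  · exact one_mem _
  · exact hG

theorem chainLayer_mul_conjTranspose (x : ZMod (2 * L)) {G : Gate d}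
    (hG : G ∈ Matrix.unitaryGroup (Fin d × Fin d) ℂ) :
    chainLayer L G x * (chainLayer L G x).conjTranspose = 1 :=
  layerFam_mul_conjTranspose _ fun _ => hG

theorem agreeOff_of_pairAt {x : ZMod (2 * L)} {m : ℕ} {s t : ZMod (2 * L) → Fin d}
    (h : ∀ j : Fin L, m ≤ (j : ℕ) → pairAt x s j = pairAt x t j) : AgreeOff x (2 * m) s t := by
  intro y hy
  obtain ⟨⟨j, b⟩, rfl⟩ := (sitePairs x).surjective y
  have hj : m ≤ (j : ℕ) := by
    by_contra hlt
    refine hy.ne (i := 2 * (j : ℕ) + (b : ℕ)) (by omega) ?_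
    rw [sitePairs_apply]
    push_cast
    ring
  have := h j hj
  simp only [pairAt, Prod.mk.injEq] at this
  fin_cases b
  · simpa [sitePairs_apply] using this.1
  · simpa [sitePairs_apply] using this.2

theorem placeAt_rowLayer {n m : ℕ} (hn : n = 2 * m) (hm : m ≤ L) (x : ZMod (2 * L)) (G : Gate d) :
    placeAt x (rowLayer n G) = rowPart x m G := by
  subst hn
  ext s t
  rw [rowPart, layerFam_apply]
  by_cases h : AgreeOff x (2 * m) s t
  · rw [placeAt_of_agree _ h, rowLayer]
    let F : ℕ → ℂ := fun j => G
      (s (2 * (j : ZMod (2 * L)) + x), s (2 * (j : ZMod (2 * L)) + x + 1))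
      (t (2 * (j : ZMod (2 * L)) + x), t (2 * (j : ZMod (2 * L)) + x + 1))
    have h1 : ∀ j : Fin L, (if (j : ℕ) < m then G else 1) (pairAt x s j) (pairAt x t j) =
        if (j : ℕ) < m then F j else 1 := by
      intro j
      split_ifs with hj
      · rfl
      · rw [pairAt_of_agreeOff h (by omega)]
        exact Matrix.one_apply_eq _
    rw [Finset.prod_congr rfl fun j _ => h1 j,
      Fin.prod_univ_eq_prod_range (fun j => if j < m then F j else 1) L]
    have h2 : ∀ j : Fin (2 * m / 2), G
        (restrictArc x (2 * m) s ⟨2 * j, by omega⟩, restrictArc x (2 * m) s ⟨2 * j + 1, by omega⟩)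
        (restrictArc x (2 * m) t ⟨2 * j, by omega⟩, restrictArc x (2 * m) t ⟨2 * j + 1, by omega⟩) =
        F j := by
      intro j
      simp only [restrictArc, F]
      push_cast
      rw [← add_assoc, add_comm x]
    rw [Finset.prod_congr rfl fun j _ => h2 j, Fin.prod_univ_eq_prod_range F,
      Nat.mul_div_cancel_left m two_pos, ← Finset.prod_filter]
    refine Finset.prod_congr ?_ fun _ _ => rfl
    ext j
    simp only [Finset.mem_range, Finset.mem_filter]
    omega
  · rw [placeAt_of_not_agree _ h]
    have : ¬ ∀ j : Fin L, m ≤ (j : ℕ) → pairAt x s j = pairAt x t j :=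
      fun h' => h (agreeOff_of_pairAt h')
    push Not at this
    obtain ⟨j, hj, hne⟩ := this
    refine (Finset.prod_eq_zero (Finset.mem_univ j) ?_).symm
    rw [if_neg (by omega)]
    exact Matrix.one_apply_ne hne

/-- One factor is diagonal on the arc and the other off it, so each product has a single
contributing intermediate configuration. The arc has even length so that it cuts no gate. -/
theorem commute_restPart {m : ℕ} (hm : m ≤ L) (x : ZMod (2 * L)) (G : Gate d)
    (A : LocalOp d (2 * m)) : Commute (restPart x m G) (placeAt x A) := by
  have hw : 2 * m ≤ 2 * L := by omega
  ext s t
  rw [Matrix.mul_apply, Matrix.mul_apply,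
    Finset.sum_eq_single (glue x (restrictArc x (2 * m) s) t),
    Finset.sum_eq_single (glue x (restrictArc x (2 * m) t) s)]
  · rw [placeAt_of_agree _ (agreeOff_glue _ _ _), placeAt_of_agree _ (agreeOff_glue _ _ _).symm,
      restrictArc_glue hw, restrictArc_glue hw, mul_comm]
    congr 1
    exact restPart_congr (restrictArc_glue hw _ _ _).symm (restrictArc_glue hw _ _ _)
      (agreeOff_glue _ _ _).symm (agreeOff_glue _ _ _)
  · intro u _ hu
    by_cases h1 : restrictArc x (2 * m) u = restrictArc x (2 * m) t
    · rw [placeAt_of_not_agree, zero_mul]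
      intro h2
      exact hu (eq_of_restrictArc_eq (h2.symm.trans (agreeOff_glue _ _ _).symm)
        (h1.trans (restrictArc_glue hw _ _ _).symm))
    · rw [restPart_eq_zero hm h1, mul_zero]
  · simp
  · intro u _ hu
    by_cases h1 : restrictArc x (2 * m) s = restrictArc x (2 * m) u
    · rw [placeAt_of_not_agree, mul_zero]
      intro h2
      exact hu (eq_of_restrictArc_eq (h2.trans (agreeOff_glue _ _ _).symm)
        (h1.symm.trans (restrictArc_glue hw _ _ _).symm))
    · rw [restPart_eq_zero hm h1, zero_mul]
  · simp

/-- The gates off the arc commute with the operator and cancel against their adjoints. -/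
theorem chainLayer_conj_placeAt {n m : ℕ} (hn : n = 2 * m) (hm : m ≤ L) (x : ZMod (2 * L))
    {G : Gate d} (hG : G ∈ Matrix.unitaryGroup (Fin d × Fin d) ℂ) (A : LocalOp d n) :
    chainLayer L G x * placeAt x A * (chainLayer L G x).conjTranspose =
      placeAt x (rowLayer n G * A * (rowLayer n G).conjTranspose) := by
  have hw : n ≤ 2 * L := by omega
  rw [placeAt_mul hw, placeAt_mul hw, placeAt_conjTranspose, placeAt_rowLayer hn hm,
    chainLayer_eq_mul x m, Matrix.conjTranspose_mul]
  subst hn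
  calc rowPart x m G * restPart x m G * placeAt x A *
        ((restPart x m G).conjTranspose * (rowPart x m G).conjTranspose)
      = rowPart x m G * (restPart x m G * placeAt x A) * (restPart x m G).conjTranspose *
          (rowPart x m G).conjTranspose := by simp only [Matrix.mul_assoc]
    _ = rowPart x m G * placeAt x A * (restPart x m G * (restPart x m G).conjTranspose) *
          (rowPart x m G).conjTranspose := by
        rw [(commute_restPart hm x G A).eq]
        simp only [Matrix.mul_assoc]
    _ = _ := by rw [restPart_mul_conjTranspose x m hG, mul_one]

/-- Turns commutation of distant gates with site units, the hypothesis of `siteAvg_conj`, into a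
case of `commute_restPart`. -/
theorem siteUnit_eq_placeAt (y : ZMod (2 * L)) (i j : Fin d) :
    (siteUnit y i j : ChainOp d L) =
      placeAt y (Matrix.single (fun _ : Fin 1 => i) (fun _ => j) (1 : ℂ)) := by
  ext s t
  have hL := NeZero.pos L
  have h1 : ∀ s : ZMod (2 * L) → Fin d, restrictArc y 1 s = fun _ => s y := by
    intro s
    funext k
    simp [restrictArc]
  have h2 : (s y = i ∧ t = Function.update s y j) ↔
      AgreeOff y 1 s t ∧ i = s y ∧ j = t y := by
    constructor
    · rintro ⟨rfl, rfl⟩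
      refine ⟨fun z hz => ?_, rfl, by simp⟩
      have : z ≠ y := by simpa using hz.ne (i := 0) one_pos
      simp [this]
    · rintro ⟨h, rfl, rfl⟩
      refine ⟨rfl, funext fun z => ?_⟩
      by_cases hz : z = y
      · subst hz
        simp
      · rw [Function.update_of_ne hz]
        refine (h z fun k => ?_).symm
        simpa using hz
  have h3 : ∀ i j : Fin d, ((fun _ : Fin 1 => i) = fun _ => j) ↔ i = j :=
    fun i j => ⟨fun h => congrFun h 0, fun h => h ▸ rfl⟩
  rw [siteUnit]
  by_cases h : AgreeOff y 1 s t
  · rw [placeAt_of_agree _ h, h1, h1, Matrix.single_apply]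
    refine if_congr ?_ rfl rfl
    rw [h2, h3, h3]
    tauto
  · rw [placeAt_of_not_agree _ h, if_neg fun h' => h (h2.1 h').1]

theorem commute_restPart_siteUnit_left (y : ZMod (2 * L)) (G : Gate d) (i j : Fin d) :
    Commute (restPart y 1 G) (siteUnit y i j) := by
  have hL := NeZero.pos L
  rw [siteUnit_eq_placeAt, ← placeAt_tensorOne (by omega)]
  exact commute_restPart (m := 1) hL y G _

theorem commute_restPart_siteUnit_right (y : ZMod (2 * L)) (G : Gate d) (i j : Fin d) :
    Commute (restPart y 1 G) (siteUnit (y + 1) i j) := by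
  have hL := NeZero.pos L
  rw [siteUnit_eq_placeAt, ← placeAt_oneTensor (by omega)]
  exact commute_restPart (m := 1) hL y G _

end RowLayer

/-! ### Two-site blocks of chain operators. -/

section PairConj

variable {d L : ℕ}

/-- The configuration `s` with the values at the sites `y`, `y + 1` replaced by `p`. -/
def updatePair (y : ZMod (2 * L)) (s : ZMod (2 * L) → Fin d) (p : Fin d × Fin d) :
    ZMod (2 * L) → Fin d :=
  Function.update (Function.update s y p.1) (y + 1) p.2

theorem updatePair_right (y : ZMod (2 * L)) (s : ZMod (2 * L) → Fin d) (p : Fin d × Fin d) :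
    updatePair y s p (y + 1) = p.2 := by
  simp [updatePair]

theorem update_right_updatePair (y : ZMod (2 * L)) (s : ZMod (2 * L) → Fin d) (p : Fin d × Fin d)
    (i : Fin d) : Function.update (updatePair y s p) (y + 1) i = updatePair y s (p.1, i) := by
  simp only [updatePair]
  rw [Function.update_idem]

theorem updatePair_self (y : ZMod (2 * L)) (s : ZMod (2 * L) → Fin d) :
    updatePair y s (s y, s (y + 1)) = s := by
  simp [updatePair]

/-- The matrix of a chain operator in the sites `y`, `y + 1`, with the other sites in the
configurations `s` and `t`. -/
def gateBlock (y : ZMod (2 * L)) (s t : ZMod (2 * L) → Fin d) (A : ChainOp d L) : Gate d :=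
  Matrix.of fun p q => A (updatePair y s p) (updatePair y t q)

theorem gateBlock_apply (y : ZMod (2 * L)) (s t : ZMod (2 * L) → Fin d) (A : ChainOp d L)
    (p q : Fin d × Fin d) :
    gateBlock y s t A p q = A (updatePair y s p) (updatePair y t q) := rfl

/-- Averages at `y`, `y + 1` and conjugation by one gate there act block by block, so chain
identities built from them follow from identities for `d² × d²` matrices. -/
theorem eq_of_gateBlock_eq {y : ZMod (2 * L)} {A B : ChainOp d L}
    (h : ∀ s t, gateBlock y s t A = gateBlock y s t B) : A = B := by
  ext s t
  have := congrFun (congrFun (h s t) (s y, s (y + 1))) (t y, t (y + 1))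
  rwa [gateBlock_apply, gateBlock_apply, updatePair_self, updatePair_self] at this

theorem gateBlock_siteAvg_right (y : ZMod (2 * L)) (s t : ZMod (2 * L) → Fin d)
    (A : ChainOp d L) :
    gateBlock y s t (siteAvg (y + 1) A) = gateAvgRight (gateBlock y s t A) := by
  ext ⟨i, j⟩ ⟨k, l⟩
  rw [gateBlock_apply, gateAvgRight_apply, siteAvg_apply, updatePair_right, updatePair_right]
  simp only [update_right_updatePair, gateBlock_apply]

variable [NeZero L]

theorem self_ne_add_one (y : ZMod (2 * L)) : y ≠ y + 1 := by
  intro h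
  have h1 : ((0 : ℕ) : ZMod (2 * L)) = ((1 : ℕ) : ZMod (2 * L)) := by
    push_cast
    linear_combination h
  have := zmod_natCast_inj (by have := NeZero.pos L; omega) (by have := NeZero.pos L; omega) h1
  omega

theorem updatePair_left (y : ZMod (2 * L)) (s : ZMod (2 * L) → Fin d) (p : Fin d × Fin d) :
    updatePair y s p y = p.1 := by
  simp [updatePair, self_ne_add_one y]

theorem update_left_updatePair (y : ZMod (2 * L)) (s : ZMod (2 * L) → Fin d) (p : Fin d × Fin d)
    (i : Fin d) : Function.update (updatePair y s p) y i = updatePair y s (i, p.2) := by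
  simp only [updatePair]
  rw [Function.update_comm (self_ne_add_one y).symm, Function.update_idem]

theorem agreeOff_two {y : ZMod (2 * L)} {s t : ZMod (2 * L) → Fin d} :
    AgreeOff y 2 s t ↔ t = updatePair y s (t y, t (y + 1)) := by
  constructor
  · intro h
    funext z
    by_cases h1 : z = y
    · subst h1
      rw [updatePair_left]
    by_cases h2 : z = y + 1
    · subst h2
      rw [updatePair_right]
    rw [updatePair, Function.update_of_ne h2, Function.update_of_ne h1]
    refine (h z (offArc_iff.2 fun i hi => ?_)).symm
    interval_cases i <;> simpa
  · intro h z hz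
    have h1 : z ≠ y := by simpa using hz.ne (i := 0) (by norm_num)
    have h2 : z ≠ y + 1 := by simpa using hz.ne (i := 1) (by norm_num)
    rw [h, updatePair, Function.update_of_ne h2, Function.update_of_ne h1]

theorem gateBlock_siteAvg_left (y : ZMod (2 * L)) (s t : ZMod (2 * L) → Fin d) (A : ChainOp d L) :
    gateBlock y s t (siteAvg y A) = gateAvgLeft (gateBlock y s t A) := by
  ext ⟨i, j⟩ ⟨k, l⟩
  rw [gateBlock_apply, gateAvgLeft_apply, siteAvg_apply, updatePair_left, updatePair_left]
  simp only [update_left_updatePair, gateBlock_apply]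

theorem rowPart_one_apply (y : ZMod (2 * L)) (G : Gate d) (s t : ZMod (2 * L) → Fin d)
    (h : AgreeOff y 2 s t) :
    rowPart y 1 G s t = G (s y, s (y + 1)) (t y, t (y + 1)) := by
  rw [← placeAt_rowLayer (n := 2) rfl (NeZero.pos L), placeAt_of_agree _ h, rowLayer]
  simp [restrictArc]

theorem rowPart_mul_apply (y : ZMod (2 * L)) (G : Gate d) (A : ChainOp d L)
    (s t : ZMod (2 * L) → Fin d) (p : Fin d × Fin d) :
    (rowPart y 1 G * A) (updatePair y s p) t = ∑ q, G p q * A (updatePair y s q) t := by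
  rw [Matrix.mul_apply]
  have hag : ∀ q, AgreeOff y 2 (updatePair y s p) (updatePair y s q) := by
    intro q
    rw [agreeOff_two, updatePair_left, updatePair_right]
    change _ = Function.update (Function.update (updatePair y s p) y q.1) (y + 1) q.2
    rw [update_left_updatePair, update_right_updatePair]
  refine (Finset.sum_of_injOn (fun q => updatePair y s q) ?_ (by intro; simp) ?_ ?_).symm
  · intro p _ q _ hpq
    have h1 := congrFun hpq y
    have h2 := congrFun hpq (y + 1)
    simp only [updatePair_left, updatePair_right] at h1 h2
    exact Prod.ext h1 h2
  · intro u _ hu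
    rw [← placeAt_rowLayer (n := 2) rfl (NeZero.pos L), placeAt_of_not_agree, zero_mul]
    intro h
    refine hu ⟨(u y, u (y + 1)), by simp, ?_⟩
    exact (agreeOff_two.1 ((hag (s y, s (y + 1))).symm.trans h) |>.trans
      (by rw [updatePair_self])).symm
  · intro q _
    rw [rowPart_one_apply y G _ _ (hag q)]
    simp only [updatePair_left, updatePair_right]

theorem gateBlock_conj (y : ZMod (2 * L)) (G : Gate d) (A : ChainOp d L)
    (s t : ZMod (2 * L) → Fin d) :
    gateBlock y s t (rowPart y 1 G * A * (rowPart y 1 G).conjTranspose) =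
      G * gateBlock y s t A * G.conjTranspose := by
  ext p q
  have h : ∀ X : ChainOp d L, ∀ s t q, (X * (rowPart y 1 G).conjTranspose) s (updatePair y t q) =
      ∑ q', X s (updatePair y t q') * star (G q q') := by
    intro X s t q
    have := congrArg star (rowPart_mul_apply y G X.conjTranspose t s q)
    rw [← Matrix.conjTranspose_apply, Matrix.conjTranspose_mul, Matrix.conjTranspose_conjTranspose]
      at this
    rw [this, star_sum]
    refine Finset.sum_congr rfl fun q' _ => ?_
    rw [star_mul, Matrix.conjTranspose_apply, star_star]
  rw [gateBlock_apply, h, Matrix.mul_apply]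
  refine Finset.sum_congr rfl fun q' _ => ?_
  rw [rowPart_mul_apply, Matrix.conjTranspose_apply, Matrix.mul_apply]
  rfl

end PairConj

/-! ### How one layer acts on trivial and traceless sites. -/

section LightCone

variable {d L : ℕ} [NeZero L]

/-- Conjugation by a chain operator. -/
noncomputable def conjBy (W : ChainOp d L) : ChainOp d L →ₗ[ℂ] ChainOp d L where
  toFun A := W * A * W.conjTranspose
  map_add' A B := by rw [mul_add, add_mul]
  map_smul' c A := by simp

theorem conjBy_apply (W A : ChainOp d L) : conjBy W A = W * A * W.conjTranspose := rfl

theorem conjBy_mul (W W' A : ChainOp d L) : conjBy (W * W') A = conjBy W (conjBy W' A) := by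
  simp only [conjBy_apply, Matrix.conjTranspose_mul, Matrix.mul_assoc]

theorem hs_conjBy (W A B : ChainOp d L) :
    hs B (conjBy W A) = hs (conjBy W.conjTranspose B) A := by
  rw [conjBy_apply, hs_conj, conjBy_apply, Matrix.conjTranspose_conjTranspose]

theorem conjBy_chainLayer (y : ZMod (2 * L)) (G : Gate d) (A : ChainOp d L) :
    conjBy (chainLayer L G y) A = conjBy (rowPart y 1 G) (conjBy (restPart y 1 G) A) := by
  rw [chainLayer_eq_mul y 1, conjBy_mul]

theorem siteAvg_restPart_left (y : ZMod (2 * L)) (G : Gate d) (A : ChainOp d L) :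
    siteAvg y (conjBy (restPart y 1 G) A) = conjBy (restPart y 1 G) (siteAvg y A) :=
  siteAvg_conj (commute_restPart_siteUnit_left y G) A

theorem siteAvg_restPart_right (y : ZMod (2 * L)) (G : Gate d) (A : ChainOp d L) :
    siteAvg (y + 1) (conjBy (restPart y 1 G) A) = conjBy (restPart y 1 G) (siteAvg (y + 1) A) :=
  siteAvg_conj (commute_restPart_siteUnit_right y G) A

/-- Every two-site block of such an operator is scalar, so unitarity of the gate suffices. -/
theorem conjBy_rowPart_of_trivial {y : ZMod (2 * L)} {G : Gate d}
    (hG : G ∈ Matrix.unitaryGroup (Fin d × Fin d) ℂ) {A : ChainOp d L}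
    (h1 : siteAvg y A = A) (h2 : siteAvg (y + 1) A = A) : conjBy (rowPart y 1 G) A = A := by
  have h : A = siteAvg y (siteAvg (y + 1) A) := by rw [h2, h1]
  rw [conjBy_apply, h]
  refine eq_of_gateBlock_eq (y := y) fun s t => ?_
  rw [gateBlock_conj, gateBlock_siteAvg_left, gateBlock_siteAvg_right, gate_conj_gateAvg hG]

theorem siteAvg_right_conjBy_rowPart {y : ZMod (2 * L)} {G : Gate d} (hG : IsDualUnitary G)
    (A : ChainOp d L) : siteAvg (y + 1) (conjBy (rowPart y 1 G) (siteAvg (y + 1) A)) =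
      siteAvg y (siteAvg (y + 1) A) := by
  refine eq_of_gateBlock_eq (y := y) fun s t => ?_
  rw [gateBlock_siteAvg_right, conjBy_apply, gateBlock_conj, gateBlock_siteAvg_left,
    gateBlock_siteAvg_right, gateAvgRight_conj hG]

theorem siteAvg_left_conjBy_rowPart {y : ZMod (2 * L)} {G : Gate d} (hG : IsDualUnitary G)
    (A : ChainOp d L) : siteAvg y (conjBy (rowPart y 1 G) (siteAvg y A)) =
      siteAvg y (siteAvg (y + 1) A) := by
  refine eq_of_gateBlock_eq (y := y) fun s t => ?_
  rw [gateBlock_siteAvg_left, conjBy_apply, gateBlock_conj, gateBlock_siteAvg_left,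
    gateBlock_siteAvg_left, gateBlock_siteAvg_right, gateAvgLeft_conj hG]

/-- The behaviour of a layer of dual-unitary gates at a pair of sites `(y, y + 1)` on which one of
the gates acts. -/
structure IsLightConeAt (T : ChainOp d L →ₗ[ℂ] ChainOp d L) (y : ZMod (2 * L)) : Prop where
  trivial_left : ∀ A, siteAvg y A = A → siteAvg (y + 1) A = A → siteAvg y (T A) = T A
  trivial_right : ∀ A, siteAvg y A = A → siteAvg (y + 1) A = A → siteAvg (y + 1) (T A) = T A
  right : ∀ A, siteAvg y A = 0 → siteAvg (y + 1) A = A → siteAvg (y + 1) (T A) = 0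
  left : ∀ A, siteAvg y A = A → siteAvg (y + 1) A = 0 → siteAvg y (T A) = 0

/-- Conjugation by the other gates commutes with the averages at `y` and `y + 1`, so only the single
gate on this pair matters. -/
theorem isLightConeAt_chainLayer (y : ZMod (2 * L)) {G : Gate d} (hG : IsDualUnitary G) :
    IsLightConeAt (conjBy (chainLayer L G y)) y := by
  have ht : ∀ A, siteAvg y A = A → siteAvg (y + 1) A = A →
      conjBy (chainLayer L G y) A = conjBy (restPart y 1 G) A := by
    intro A h1 h2
    rw [conjBy_chainLayer]
    exact conjBy_rowPart_of_trivial hG.1 (by rw [siteAvg_restPart_left, h1])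
      (by rw [siteAvg_restPart_right, h2])
  refine ⟨fun A h1 h2 => ?_, fun A h1 h2 => ?_, fun A h1 h2 => ?_, fun A h1 h2 => ?_⟩
  · rw [ht A h1 h2, siteAvg_restPart_left, h1]
  · rw [ht A h1 h2, siteAvg_restPart_right, h2]
  · have h := siteAvg_right_conjBy_rowPart (y := y) hG (conjBy (restPart y 1 G) A)
    rwa [siteAvg_restPart_right, h2, siteAvg_restPart_left, h1, map_zero, ← conjBy_chainLayer] at h
  · have h := siteAvg_left_conjBy_rowPart (y := y) hG (conjBy (restPart y 1 G) A)
    rwa [siteAvg_restPart_left, h1, siteAvg_restPart_right, h2, map_zero, map_zero,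
      ← conjBy_chainLayer] at h

end LightCone

/-! ### Bands and the motion of their ends. -/

section Band

variable {d L : ℕ}

/-- The operator acts trivially off the arc of `w` sites that starts at `x`. -/
def SupportedOn (A : ChainOp d L) (x : ZMod (2 * L)) (w : ℕ) : Prop :=
  ∀ y, OffArc x w y → siteAvg y A = A

/-- The operator acts trivially off the arc of `w` sites that starts at `x`, and its partial traces
over both boundary sites of this arc vanish. -/
structure IsBand (A : ChainOp d L) (x : ZMod (2 * L)) (w : ℕ) : Prop where
  supp : SupportedOn A x w
  left : siteAvg x A = 0
  right : siteAvg (x + (w : ZMod (2 * L)) - 1) A = 0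

theorem natCast_eq_of_add_eq {x : ZMod (2 * L)} {w w' : ℕ} (hw : w < 2 * L) (hw' : w' < 2 * L)
    (h : x + (w : ZMod (2 * L)) = x + (w' : ZMod (2 * L))) : w = w' :=
  zmod_natCast_inj hw hw' (add_left_cancel h)

theorem siteAvg_layer {T : ChainOp d L →ₗ[ℂ] ChainOp d L} {y : ZMod (2 * L)}
    (hT : IsLightConeAt T y ∨ IsLightConeAt T (y - 1)) {A : ChainOp d L}
    (h0 : siteAvg (y - 1) A = A) (h1 : siteAvg y A = A) (h2 : siteAvg (y + 1) A = A) :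
    siteAvg y (T A) = T A := by
  rcases hT with hT | hT
  · exact hT.trivial_left A h1 h2
  · have := hT.trivial_right A h0 (by rwa [sub_add_cancel])
    rwa [sub_add_cancel] at this

theorem isBand_placeAt [NeZero d] {w : ℕ} (hw1 : 1 ≤ w) (hw : w ≤ 2 * L) (x : ZMod (2 * L))
    {a : LocalOp d w} (ha : IsBoundaryTraceless a) : IsBand (placeAt x a) x w := by
  refine ⟨fun y hy => siteAvg_placeAt_off hy a, ?_, ?_⟩
  · have := siteAvg_placeAt_traceless hw x (ha ⟨0, hw1⟩ (Or.inl rfl))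
    simpa using this
  · have := siteAvg_placeAt_traceless hw x (ha ⟨w - 1, by omega⟩
      (Or.inr (by simp only; omega)))
    simp only [Nat.cast_sub hw1, Nat.cast_one] at this
    rwa [← add_sub_assoc] at this

/-- A site off the enlarged arc has both neighbours off the original one, so its gate acts on two
trivial sites whichever neighbour it is paired with. -/
theorem SupportedOn.layer {T : ChainOp d L →ₗ[ℂ] ChainOp d L}
    (hT : ∀ y, IsLightConeAt T y ∨ IsLightConeAt T (y - 1)) {A : ChainOp d L} {x : ZMod (2 * L)}
    {w : ℕ} (hA : SupportedOn A x w) : SupportedOn (T A) (x - 1) (w + 2) := by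
  intro y hy
  refine siteAvg_layer (hT y) (hA _ ?_) (hA _ ?_) (hA _ ?_)
  · intro i hi
    refine hy.ne (i := (i : ℕ) + 2) (by omega) ?_
    push_cast
    linear_combination hi
  · intro i hi
    refine hy.ne (i := (i : ℕ) + 1) (by omega) ?_
    push_cast
    linear_combination hi
  · intro i hi
    refine hy.ne (i := (i : ℕ)) (by omega) ?_
    linear_combination hi

/-- One period of a brickwork circuit of dual-unitary gates, in whose first layer the gates act on
the pairs of sites `(y, y + 1)` with `p y`. -/
structure IsBrickStep (E : ChainOp d L →ₗ[ℂ] ChainOp d L) (p : ZMod (2 * L) → Prop) : Prop where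
  supp : ∀ {A x w}, SupportedOn A x w → SupportedOn (E A) (x - 2) (w + 4)
  right : ∀ {A x w}, w + 3 ≤ 2 * L → SupportedOn A x w → siteAvg (x + (w : ZMod (2 * L)) - 1) A = 0 →
    p (x + (w : ZMod (2 * L)) - 1) → siteAvg (x + (w : ZMod (2 * L)) + 1) (E A) = 0
  left : ∀ {A x w}, w + 3 ≤ 2 * L → SupportedOn A x w → siteAvg x A = 0 → p (x - 1) →
    siteAvg (x - 2) (E A) = 0

/-- For a right end `z` with `p z`, the first layer carries tracelessness from `z` to `z + 1` and
leaves `z + 2` trivial, since its gate on `(z + 2, z + 3)` sees only trivial sites. The second layer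
then carries tracelessness from `z + 1` to `z + 2`. Three trivial sites beyond the end are used,
whence `w + 3 ≤ 2 * L`. -/
theorem isBrickStep_comp {T T' : ChainOp d L →ₗ[ℂ] ChainOp d L} {p : ZMod (2 * L) → Prop}
    (hT : ∀ y, p y → IsLightConeAt T y) (hT' : ∀ y, p y → IsLightConeAt T' (y + 1))
    (hp : ∀ y, p y ∨ p (y - 1)) (hp2 : ∀ y, p y → p (y + 2)) (hp2' : ∀ y, p y → p (y - 2)) :
    IsBrickStep (T' ∘ₗ T) p := by
  have h1 : ∀ y, IsLightConeAt T y ∨ IsLightConeAt T (y - 1) := fun y =>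
    (hp y).imp (hT y) (hT _)
  have h2 : ∀ y, IsLightConeAt T' y ∨ IsLightConeAt T' (y - 1) := by
    intro y
    rcases hp (y - 1) with h | h
    · have := hT' _ h
      rw [sub_add_cancel] at this
      exact Or.inl this
    · have := hT' _ h
      rw [sub_add_cancel] at this
      exact Or.inr this
  refine ⟨fun {A x w} hA => ?_, fun {A x w} hw hA h0 hpz => ?_, fun {A x w} hw hA h0 hpx => ?_⟩
  · have := (hA.layer h1).layer h2
    rwa [sub_sub, one_add_one_eq_two] at this
  · obtain ⟨z, rfl⟩ : ∃ z, z + 1 - (w : ZMod (2 * L)) = x := ⟨x + (w : ZMod (2 * L)) - 1, by ring⟩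
    have hz : ∀ k : ℕ, 1 ≤ k → k ≤ 3 → siteAvg (z + (k : ZMod (2 * L))) A = A := by
      intro k hk1 hk2
      refine hA _ ?_
      have := offArc_add (z + 1 - (w : ZMod (2 * L))) (w := w) (k := w + (k - 1)) (by omega)
        (by omega)
      convert this using 1
      push_cast [Nat.cast_sub hk1]
      ring
    have e1 : z + 1 - (w : ZMod (2 * L)) + (w : ZMod (2 * L)) - 1 = z := by ring
    have e2 : z + 1 - (w : ZMod (2 * L)) + (w : ZMod (2 * L)) + 1 = z + 1 + 1 := by ring
    rw [e1] at h0 hpz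
    rw [e2]
    have a1 : siteAvg (z + 1) A = A := by simpa using hz 1 (by norm_num) (by norm_num)
    have a2 : siteAvg (z + 2) A = A := by simpa using hz 2 (by norm_num) (by norm_num)
    have a3 : siteAvg (z + 2 + 1) A = A := by
      have := hz 3 (by norm_num) (by norm_num)
      convert this using 3
      push_cast
      ring
    have b1 := (hT z hpz).right A h0 a1
    have b2 := (hT _ (hp2 z hpz)).trivial_left A a2 a3
    refine (hT' z hpz).right _ b1 ?_
    rwa [add_assoc, one_add_one_eq_two]
  · have hz : ∀ k : ℕ, 1 ≤ k → k ≤ 3 → siteAvg (x - (k : ZMod (2 * L))) A = A := fun k hk1 hk2 =>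
      hA _ (offArc_sub x hk1 (by omega))
    have a1 : siteAvg (x - 1) A = A := by simpa using hz 1 (by norm_num) (by norm_num)
    have a2 : siteAvg (x - 1 - 2 + 1) A = A := by
      have := hz 2 (by norm_num) (by norm_num)
      convert this using 3
      push_cast
      ring
    have a3 : siteAvg (x - 1 - 2) A = A := by
      have := hz 3 (by norm_num) (by norm_num)
      convert this using 3
      push_cast
      ring
    have b1 := (hT _ hpx).left A a1 (by rwa [sub_add_cancel])
    have b2 := (hT _ (hp2' _ hpx)).trivial_right A a3 a2
    have c := (hT' _ (hp2' _ hpx)).left (T A) b2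
    have e : x - 1 - 2 + 1 = x - 2 := by ring
    rw [e] at c
    refine c ?_
    convert b1 using 3
    ring

variable [NeZero L]

theorem hs_eq_zero_of_siteAvg {A B : ChainOp d L} {y : ZMod (2 * L)} (hA : siteAvg y A = A)
    (hB : siteAvg y B = 0) : hs A B = 0 := by
  rw [← hA, hs_siteAvg, hB, hs_zero_right]

theorem hs_eq_zero_of_siteAvg' {A B : ChainOp d L} {y : ZMod (2 * L)} (hA : siteAvg y A = 0)
    (hB : siteAvg y B = B) : hs A B = 0 := by
  rw [← hB, ← hs_siteAvg, hA, hs_zero_left]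

/-- Each start must lie in the other arc, or a trivial site would meet a traceless one. The two
offsets add up to zero modulo `2 * L`, and the width bound makes their sum smaller than `2 * L`, so
both vanish. -/
theorem left_eq_of_hs_ne_zero {A B : ChainOp d L} {x x' : ZMod (2 * L)} {w w' : ℕ}
    (hA : SupportedOn A x w) (hA0 : siteAvg x A = 0) (hB : SupportedOn B x' w')
    (hB0 : siteAvg x' B = 0) (hw : w + w' ≤ 2 * L + 1) (h : hs B A ≠ 0) : x' = x := by
  by_cases h1 : OffArc x' w' x
  · exact absurd (hs_eq_zero_of_siteAvg (hB _ h1) hA0) h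
  by_cases h2 : OffArc x w x'
  · exact absurd (hs_eq_zero_of_siteAvg' hB0 (hA _ h2)) h
  obtain ⟨i, hi, hi'⟩ := exists_of_not_offArc h1
  obtain ⟨j, hj, hj'⟩ := exists_of_not_offArc h2
  have h3 : ((i + j : ℕ) : ZMod (2 * L)) = ((0 : ℕ) : ZMod (2 * L)) := by
    push_cast
    linear_combination -hi' - hj'
  have h4 := zmod_natCast_inj (by omega) (by have := NeZero.pos L; omega) h3
  have h5 : i = 0 := by omega
  rw [hi', h5]
  simp

theorem right_eq_of_hs_ne_zero {A B : ChainOp d L} {x x' : ZMod (2 * L)} {w w' : ℕ}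
    (hA : SupportedOn A x w) (hA0 : siteAvg (x + (w : ZMod (2 * L)) - 1) A = 0) (hB : SupportedOn B x' w')
    (hB0 : siteAvg (x' + (w' : ZMod (2 * L)) - 1) B = 0) (hw : w + w' ≤ 2 * L + 1) (h : hs B A ≠ 0) :
    x' + (w' : ZMod (2 * L)) = x + (w : ZMod (2 * L)) := by
  by_cases h1 : OffArc x' w' (x + (w : ZMod (2 * L)) - 1)
  · exact absurd (hs_eq_zero_of_siteAvg (hB _ h1) hA0) h
  by_cases h2 : OffArc x w (x' + (w' : ZMod (2 * L)) - 1)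
  · exact absurd (hs_eq_zero_of_siteAvg' hB0 (hA _ h2)) h
  obtain ⟨i, hi, hi'⟩ := exists_of_not_offArc h1
  obtain ⟨j, hj, hj'⟩ := exists_of_not_offArc h2
  have h3 : (((w' - 1 - i) + (w - 1 - j) : ℕ) : ZMod (2 * L)) = ((0 : ℕ) : ZMod (2 * L)) := by
    push_cast [Nat.cast_sub (show i ≤ w' - 1 by omega), Nat.cast_sub (show j ≤ w - 1 by omega),
      Nat.cast_sub (show 1 ≤ w by omega), Nat.cast_sub (show 1 ≤ w' by omega)]
    linear_combination hi' + hj'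
  have h4 := zmod_natCast_inj (by omega) (by have := NeZero.pos L; omega) h3
  have h5 : i + 1 = w' := by omega
  rw [← h5]
  push_cast
  linear_combination -hi'

theorem IsBand.eq_of_hs_ne_zero {A B : ChainOp d L} {x x' : ZMod (2 * L)} {w w' : ℕ}
    (hA : IsBand A x w) (hB : IsBand B x' w') (hw : w < L) (hw' : w' < L) (h : hs B A ≠ 0) :
    x' = x ∧ w' = w := by
  have h1 := left_eq_of_hs_ne_zero hA.supp hA.left hB.supp hB.left (by omega) h
  have h2 := right_eq_of_hs_ne_zero hA.supp hA.right hB.supp hB.right (by omega) h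
  subst h1
  exact ⟨rfl, natCast_eq_of_add_eq (by omega) (by omega) h2⟩

/-- The image occupies up to `w + 4` sites, and `w + 3 ≤ L` is what keeps `(w + 4) + w' ≤ 2 * L +
1`. The far end of the image need not be traceless. -/
theorem IsBrickStep.left_eq {E : ChainOp d L →ₗ[ℂ] ChainOp d L} {p : ZMod (2 * L) → Prop}
    (hE : IsBrickStep E p) {A B : ChainOp d L} {x x' : ZMod (2 * L)} {w w' : ℕ}
    (hA : IsBand A x w) (hB : IsBand B x' w') (hw : w + 3 ≤ L) (hw' : w' ≤ L)
    (h : hs B (E A) ≠ 0) (hp : p (x - 1)) : x' = x - 2 :=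
  left_eq_of_hs_ne_zero (hE.supp hA.supp) (hE.left (by omega) hA.supp hA.left hp) hB.supp hB.left
    (by omega) h

theorem IsBrickStep.right_eq {E : ChainOp d L →ₗ[ℂ] ChainOp d L} {p : ZMod (2 * L) → Prop}
    (hE : IsBrickStep E p) {A B : ChainOp d L} {x x' : ZMod (2 * L)} {w w' : ℕ}
    (hA : IsBand A x w) (hB : IsBand B x' w') (hw : w + 3 ≤ L) (hw' : w' ≤ L)
    (h : hs B (E A) ≠ 0) (hp : p (x + (w : ZMod (2 * L)) - 1)) : x' + (w' : ZMod (2 * L)) = x + (w : ZMod (2 * L)) + 2 := by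
  have e : x - 2 + ((w + 4 : ℕ) : ZMod (2 * L)) = x + (w : ZMod (2 * L)) + 2 := by
    push_cast
    ring
  have h1 := hE.right (by omega) hA.supp hA.right hp
  rw [← e]
  refine right_eq_of_hs_ne_zero (hE.supp hA.supp) ?_ hB.supp hB.right (by omega) h
  rw [e]
  convert h1 using 3
  ring

end Band

/-! ### Which terms of a conserved quantity survive, and how they move. -/

section Classification

variable {d L : ℕ} [NeZero L]

/-- The shift by `c` permutes the sites satisfying `p`, so the squared norms add up to zero; being
nonnegative, each vanishes. -/
theorem eq_zero_of_telescoping {D : ZMod (2 * L) → ChainOp d L} {f : ZMod (2 * L) → ℂ}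
    {p : ZMod (2 * L) → Prop} {c : ZMod (2 * L)} (hp : ∀ x, p (x - c) ↔ p x)
    (h : ∀ x, p x → hs (D x) (D x) = f (x - c) - f x) : ∀ x, p x → D x = 0 := by
  classical
  open scoped ComplexOrder in
  have h1 : ∑ x, (if p x then hs (D x) (D x) else 0) = 0 := by
    have h2 : ∀ x, (if p x then hs (D x) (D x) else 0) =
        (if p (x - c) then f (x - c) else 0) - (if p x then f x else 0) := by
      intro x
      by_cases hx : p x
      · rw [if_pos hx, if_pos hx, if_pos ((hp x).2 hx), h x hx]
      · rw [if_neg hx, if_neg hx, if_neg (mt (hp x).1 hx), sub_zero]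
    rw [Finset.sum_congr rfl fun x _ => h2 x, Finset.sum_sub_distrib, sub_eq_zero]
    exact Equiv.sum_comp (Equiv.subRight c) fun x => if p x then f x else 0
  intro x hx
  open scoped ComplexOrder in
  have h3 := (Finset.sum_eq_zero_iff_of_nonneg fun x _ => by
    split_ifs
    · exact hs_self_nonneg _
    · exact le_rfl).1 h1 x (Finset.mem_univ x)
  rw [if_pos hx] at h3
  exact hs_self_eq_zero.1 h3

theorem hs_self_sub_of_isometry {A B : ChainOp d L} (h : hs B A = hs B B) :
    hs (B - A) (B - A) = hs A A - hs B B := by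
  have h1 : hs A B = hs B B := by rw [← hs_star, h, hs_star]
  rw [hs_sub_left, hs_sub_right, hs_sub_right, h, h1]
  ring

/-- A unitary period `E` of a brickwork circuit, with inverse `E'`, and a conserved sum of
operators `F w x`, each supported on `w` sites starting at `x`. -/
structure IsConservedFamily (E E' : ChainOp d L →ₗ[ℂ] ChainOp d L) (N : ℕ)
    (F : ℕ → ZMod (2 * L) → ChainOp d L) : Prop where
  width : N + 4 ≤ L
  step : IsBrickStep E Even
  step' : IsBrickStep E' Odd
  adjoint : ∀ A B, hs B (E A) = hs (E' B) A
  isometry : ∀ A B, hs (E B) (E A) = hs B A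
  band : ∀ w ∈ Finset.Icc 1 N, ∀ x, IsBand (F w x) x w
  conserved : E (∑ w ∈ Finset.Icc 1 N, ∑ x, F w x) = ∑ w ∈ Finset.Icc 1 N, ∑ x, F w x

namespace IsConservedFamily

variable {E E' : ChainOp d L →ₗ[ℂ] ChainOp d L} {N : ℕ} {F : ℕ → ZMod (2 * L) → ChainOp d L}

theorem hs_adjoint_ne_zero (h : IsConservedFamily E E' N F) {A B : ChainOp d L}
    (hne : hs B (E A) ≠ 0) : hs A (E' B) ≠ 0 := by
  rw [← hs_star, ← h.adjoint]
  simpa using hne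

theorem left_of_odd (h : IsConservedFamily E E' N F) {w w' : ℕ} (hw : w ∈ Finset.Icc 1 N)
    (hw' : w' ∈ Finset.Icc 1 N) {x x' : ZMod (2 * L)} (hne : hs (F w' x') (E (F w x)) ≠ 0)
    (hx : Odd x) : x' = x - 2 := by
  have := h.width
  rw [Finset.mem_Icc] at hw hw'
  exact h.step.left_eq (h.band w (Finset.mem_Icc.2 hw) x) (h.band w' (Finset.mem_Icc.2 hw') x')
    (by omega) (by omega) hne (hx.sub_odd odd_one)

/-- The rule for the inverse period, applied to the target band after moving `E` across the inner
product. -/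
theorem left_of_even (h : IsConservedFamily E E' N F) {w w' : ℕ} (hw : w ∈ Finset.Icc 1 N)
    (hw' : w' ∈ Finset.Icc 1 N) {x x' : ZMod (2 * L)} (hne : hs (F w' x') (E (F w x)) ≠ 0)
    (hx : Even x') : x = x' - 2 := by
  have := h.width
  rw [Finset.mem_Icc] at hw hw'
  exact h.step'.left_eq (h.band w' (Finset.mem_Icc.2 hw') x') (h.band w (Finset.mem_Icc.2 hw) x)
    (by omega) (by omega) (h.hs_adjoint_ne_zero hne) (hx.sub_odd odd_one)

theorem right_of_even (h : IsConservedFamily E E' N F) {w w' : ℕ} (hw : w ∈ Finset.Icc 1 N)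
    (hw' : w' ∈ Finset.Icc 1 N) {x x' : ZMod (2 * L)} (hne : hs (F w' x') (E (F w x)) ≠ 0)
    (hx : Odd (x + (w : ZMod (2 * L)))) :
    x' + (w' : ZMod (2 * L)) = x + (w : ZMod (2 * L)) + 2 := by
  have := h.width
  rw [Finset.mem_Icc] at hw hw'
  exact h.step.right_eq (h.band w (Finset.mem_Icc.2 hw) x) (h.band w' (Finset.mem_Icc.2 hw') x')
    (by omega) (by omega) hne (hx.sub_odd odd_one)

theorem right_of_odd (h : IsConservedFamily E E' N F) {w w' : ℕ} (hw : w ∈ Finset.Icc 1 N)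
    (hw' : w' ∈ Finset.Icc 1 N) {x x' : ZMod (2 * L)} (hne : hs (F w' x') (E (F w x)) ≠ 0)
    (hx : Even (x' + (w' : ZMod (2 * L)))) :
    x + (w : ZMod (2 * L)) = x' + (w' : ZMod (2 * L)) + 2 := by
  have := h.width
  rw [Finset.mem_Icc] at hw hw'
  exact h.step'.right_eq (h.band w' (Finset.mem_Icc.2 hw') x') (h.band w (Finset.mem_Icc.2 hw) x)
    (by omega) (by omega) (h.hs_adjoint_ne_zero hne) (hx.sub_odd odd_one)

/-- The conservation law paired with one band; orthogonality leaves only that band on the side where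
`E` is absent. -/
theorem hs_self_eq_sum (h : IsConservedFamily E E' N F) {w' : ℕ} (hw' : w' ∈ Finset.Icc 1 N)
    (x' : ZMod (2 * L)) : hs (F w' x') (F w' x') =
      ∑ w ∈ Finset.Icc 1 N, ∑ x, hs (F w' x') (E (F w x)) := by
  have hN := h.width
  have h1 : ∀ w ∈ Finset.Icc 1 N, ∀ x, hs (F w' x') (F w x) ≠ 0 → x' = x ∧ w' = w := by
    intro w hw x hne
    have h1 := Finset.mem_Icc.1 hw
    have h2 := Finset.mem_Icc.1 hw'
    exact (h.band w hw x).eq_of_hs_ne_zero (h.band w' hw' x') (by omega) (by omega) hne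
  have h2 := congrArg (hs (F w' x')) h.conserved
  simp only [map_sum, hs_sum_right] at h2
  rw [h2, Finset.sum_eq_single_of_mem w' hw', Finset.sum_eq_single_of_mem x' (Finset.mem_univ _)]
  · intro x _ hx
    by_contra hne
    exact hx (h1 w' hw' x hne).1.symm
  · intro w hw hne
    refine Finset.sum_eq_zero fun x _ => ?_
    by_contra hne'
    exact hne (h1 w hw x hne').2.symm

theorem nat_eq (h : IsConservedFamily E E' N F) {a b : ℕ} (ha : a ≤ N + 4) (hb : b ≤ N + 4)
    (hab : (a : ZMod (2 * L)) = (b : ZMod (2 * L))) : a = b := by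
  have := h.width
  have := NeZero.pos L
  exact zmod_natCast_inj (by omega) (by omega) hab

/-- Both ends of such a target are governed by the inverse rules, which force a source of the same
parities and width `w' + 4`. The induction therefore descends from the largest width. -/
theorem eq_zero_of_even_even (h : IsConservedFamily E E' N F) :
    ∀ (k w : ℕ), w ∈ Finset.Icc 1 N → N - w = k → Even w → ∀ x, Even x → F w x = 0 := by
  intro k
  induction k using Nat.strong_induction_on with
  | _ k ih =>
    intro w' hw' hk hwe x' hx'
    rw [← hs_self_eq_zero, h.hs_self_eq_sum hw']
    refine Finset.sum_eq_zero fun w hw => Finset.sum_eq_zero fun x _ => ?_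
    by_contra hne
    have h1 := h.left_of_even hw hw' hne hx'
    have h2 := h.right_of_odd hw hw' hne (hx'.add hwe.natCast)
    have hw1 := Finset.mem_Icc.1 hw
    have hw2 := Finset.mem_Icc.1 hw'
    have h3 : w = w' + 4 := by
      refine h.nat_eq (by omega) (by omega) ?_
      push_cast
      linear_combination h2 - h1
    have hx : Even x := h1 ▸ hx'.sub even_two
    have hwe' : Even w := h3 ▸ hwe.add (by decide)
    apply hne
    rw [ih (N - w) (by omega) w hw rfl hwe' x hx, map_zero, hs_zero_right]

/-- The inverse rule fixes the source's start at `x' - 2`. Sources of even width are already zero,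
and for odd width the forward rule on the right end fixes the width. The single remaining overlap
lets the norms telescope. -/
theorem map_of_even (h : IsConservedFamily E E' N F) {w : ℕ} (hw : w ∈ Finset.Icc 1 N)
    {x : ZMod (2 * L)} (hx : Even x) : E (F w x) = F w (x + 2) := by
  have key : ∀ x, Even x → F w x - E (F w (x - 2)) = 0 := by
    refine eq_zero_of_telescoping (c := 2) (f := fun x => hs (F w x) (F w x)) (fun x => ?_)
      fun x' hx' => ?_
    · exact ⟨fun h => by simpa using h.add even_two, fun h => h.sub even_two⟩
    · rw [hs_self_sub_of_isometry, h.isometry]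
      rw [h.hs_self_eq_sum hw x', Finset.sum_eq_single_of_mem w hw,
        Finset.sum_eq_single_of_mem (x' - 2) (Finset.mem_univ _)]
      · intro x _ hx
        by_contra hne
        exact hx (h.left_of_even hw hw hne hx')
      · intro v hv hvw
        refine Finset.sum_eq_zero fun x _ => ?_
        by_contra hne
        have h1 := h.left_of_even hv hw hne hx'
        have hx : Even x := h1 ▸ hx'.sub even_two
        rcases Nat.even_or_odd v with hve | hvo
        · apply hne
          rw [h.eq_zero_of_even_even _ v hv rfl hve x hx, map_zero, hs_zero_right]
        · have h2 := h.right_of_even hv hw hne (hx.add_odd hvo.natCast)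
          have hw1 := Finset.mem_Icc.1 hw
          have hw2 := Finset.mem_Icc.1 hv
          refine hvw (h.nat_eq (by omega) (by omega) ?_)
          linear_combination -h1 - h2
  have := key (x + 2) (hx.add even_two)
  rw [add_sub_cancel_right, sub_eq_zero] at this
  exact this.symm

theorem map_of_odd (h : IsConservedFamily E E' N F) {w : ℕ} (hw : w ∈ Finset.Icc 1 N)
    (hwo : Odd w) {x : ZMod (2 * L)} (hx : Odd x) : E (F w x) = F w (x - 2) := by
  have key : ∀ x, Odd x → F w x - E (F w (x - -2)) = 0 := by
    refine eq_zero_of_telescoping (c := -2) (f := fun x => hs (F w x) (F w x)) (fun x => ?_)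
      fun x' hx' => ?_
    · rw [sub_neg_eq_add]
      exact ⟨fun h => by simpa using h.sub_even even_two, fun h => h.add_even even_two⟩
    · rw [hs_self_sub_of_isometry, h.isometry]
      rw [h.hs_self_eq_sum hw x', Finset.sum_eq_single_of_mem w hw,
        Finset.sum_eq_single_of_mem (x' - -2) (Finset.mem_univ _)]
      · intro x _ hx
        by_contra hne
        have h2 := h.right_of_odd hw hw hne (hx'.add_odd hwo.natCast)
        exact hx (by linear_combination h2)
      · intro v hv hvw
        refine Finset.sum_eq_zero fun x _ => ?_
        by_contra hne
        have h2 := h.right_of_odd hv hw hne (hx'.add_odd hwo.natCast)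
        rcases zmod_two_mul_even_or_odd x with hx | hx
        · rcases Nat.even_or_odd v with hve | hvo
          · apply hne
            rw [h.eq_zero_of_even_even _ v hv rfl hve x hx, map_zero, hs_zero_right]
          · have h1 := h.right_of_even hv hw hne (hx.add_odd hvo.natCast)
            -- The forward rule moves this source's right end by `+2`, while the inverse rule for
            -- the target demands `-2`; the ring is too long for these to coincide.
            have h4 : 4 = 0 := by
              refine h.nat_eq (by omega) (by omega) ?_
              push_cast
              linear_combination -h1 - h2
            omega
        · have h1 := h.left_of_odd hv hw hne hx
          have hw1 := Finset.mem_Icc.1 hw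
          have hw2 := Finset.mem_Icc.1 hv
          refine hvw (h.nat_eq (by omega) (by omega) ?_)
          linear_combination h2 + h1
  have := key (x - 2) (hx.sub_even even_two)
  rw [sub_neg_eq_add, sub_add_cancel, sub_eq_zero] at this
  exact this.symm

/-- Odd-width terms are mapped to terms of the same odd width, hence orthogonal to this one. Among
even widths only odd starts remain, and their ends both move outwards, so the source has width `w' -
4` and the induction ascends. -/
theorem eq_zero_of_odd_even (h : IsConservedFamily E E' N F) :
    ∀ w, w ∈ Finset.Icc 1 N → Even w → ∀ x, Odd x → F w x = 0 := by
  intro w'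
  induction w' using Nat.strong_induction_on with
  | _ w' ih =>
    intro hw' hwe x' hx'
    have hw2 := Finset.mem_Icc.1 hw'
    have hN := h.width
    rw [← hs_self_eq_zero, h.hs_self_eq_sum hw']
    refine Finset.sum_eq_zero fun w hw => Finset.sum_eq_zero fun x _ => ?_
    have hw1 := Finset.mem_Icc.1 hw
    by_contra hne
    rcases Nat.even_or_odd w with hve | hvo
    · apply hne
      rcases zmod_two_mul_even_or_odd x with hx | hx
      · rw [h.eq_zero_of_even_even _ w hw rfl hve x hx, map_zero, hs_zero_right]
      · have h1 := h.left_of_odd hw hw' hne hx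
        have h2 := h.right_of_even hw hw' hne (hx.add_even hve.natCast)
        have h3 : w' = w + 4 := by
          refine h.nat_eq (by omega) (by omega) ?_
          push_cast
          linear_combination h2 - h1
        rw [ih w (by omega) hw hve x hx, map_zero, hs_zero_right]
    · have h3 : ∃ z, E (F w x) = F w z := by
        rcases zmod_two_mul_even_or_odd x with hx | hx
        · exact ⟨_, h.map_of_even hw hx⟩
        · exact ⟨_, h.map_of_odd hw hvo hx⟩
      obtain ⟨z, hz⟩ := h3
      rw [hz] at hne
      have h4 := ((h.band w hw z).eq_of_hs_ne_zero (h.band w' hw' x') (by omega) (by omega) hne).2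
      rw [h4] at hwe
      exact Nat.not_even_iff_odd.2 hvo hwe

theorem eq_zero_of_even_width (h : IsConservedFamily E E' N F) {w : ℕ}
    (hw : w ∈ Finset.Icc 1 N) (hwe : Even w) (x : ZMod (2 * L)) : F w x = 0 := by
  rcases zmod_two_mul_even_or_odd x with hx | hx
  · exact h.eq_zero_of_even_even _ w hw rfl hwe x hx
  · exact h.eq_zero_of_odd_even w hw hwe x hx

end IsConservedFamily

end Classification

/-! ### The Floquet operator and its transfer maps. -/

section Floquet

variable {d L : ℕ} [NeZero L]

theorem conjBy_floquet (U V : Gate d) : conjBy (floquet L U V) =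
    conjBy (chainLayer L V 1) ∘ₗ conjBy (chainLayer L U 0) :=
  LinearMap.ext fun A => conjBy_mul _ _ A

theorem conjBy_floquet_conjTranspose (U V : Gate d) : conjBy (floquet L U V).conjTranspose =
    conjBy (chainLayer L U.conjTranspose 0) ∘ₗ conjBy (chainLayer L V.conjTranspose 1) := by
  rw [floquet, Matrix.conjTranspose_mul, chainLayer_conjTranspose, chainLayer_conjTranspose]
  exact LinearMap.ext fun A => conjBy_mul _ _ A

theorem isLightConeAt_of_even {G : Gate d} (hG : IsDualUnitary G) {y : ZMod (2 * L)}
    (hy : Even y) : IsLightConeAt (conjBy (chainLayer L G 0)) y := by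
  rw [← chainLayer_of_even G hy]
  exact isLightConeAt_chainLayer y hG

theorem isLightConeAt_of_odd {G : Gate d} (hG : IsDualUnitary G) {y : ZMod (2 * L)}
    (hy : Odd y) : IsLightConeAt (conjBy (chainLayer L G 1)) y := by
  rw [← chainLayer_of_odd G hy]
  exact isLightConeAt_chainLayer y hG

theorem isBrickStep_floquet {U V : Gate d} (hU : IsDualUnitary U) (hV : IsDualUnitary V) :
    IsBrickStep (conjBy (floquet L U V)) Even := by
  rw [conjBy_floquet]
  exact isBrickStep_comp (fun y hy => isLightConeAt_of_even hU hy)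
    (fun y hy => isLightConeAt_of_odd hV hy.add_one)
    (fun y => (zmod_two_mul_even_or_odd y).imp_right fun h => h.sub_odd odd_one)
    (fun y hy => hy.add even_two) (fun y hy => hy.sub even_two)

theorem isBrickStep_floquet_conjTranspose {U V : Gate d} (hU : IsDualUnitary U)
    (hV : IsDualUnitary V) : IsBrickStep (conjBy (floquet L U V).conjTranspose) Odd := by
  rw [conjBy_floquet_conjTranspose]
  exact isBrickStep_comp (fun y hy => isLightConeAt_of_odd hV.conjTranspose hy)
    (fun y hy => isLightConeAt_of_even hU.conjTranspose hy.add_one)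
    (fun y => (zmod_two_mul_even_or_odd y).symm.imp_right fun h => h.sub_odd odd_one)
    (fun y hy => hy.add_even even_two) (fun y hy => hy.sub_even even_two)

theorem floquet_mul_conjTranspose {U V : Gate d} (hU : IsDualUnitary U) (hV : IsDualUnitary V) :
    floquet L U V * (floquet L U V).conjTranspose = 1 := by
  rw [floquet, Matrix.conjTranspose_mul, Matrix.mul_assoc,
    ← Matrix.mul_assoc _ _ (chainLayer L V 1).conjTranspose,
    chainLayer_mul_conjTranspose 0 hU.1, Matrix.one_mul, chainLayer_mul_conjTranspose 1 hV.1]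

theorem hs_conjBy_conjBy {W : ChainOp d L} (hW : W * W.conjTranspose = 1) (A B : ChainOp d L) :
    hs (conjBy W B) (conjBy W A) = hs B A := by
  have h : W.conjTranspose * W = 1 := mul_eq_one_comm.1 hW
  rw [hs_conjBy, conjBy_apply, conjBy_apply, Matrix.conjTranspose_conjTranspose]
  congr 1
  calc W.conjTranspose * (W * B * W.conjTranspose) * W
      = (W.conjTranspose * W) * B * (W.conjTranspose * W) := by simp only [Matrix.mul_assoc]
    _ = B := by rw [h, Matrix.one_mul, Matrix.mul_one]

theorem trace_placeAt_add {w : ℕ} (x c : ZMod (2 * L)) (a : LocalOp d w) :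
    (placeAt (x + c) a : ChainOp d L).trace = (placeAt x a : ChainOp d L).trace := by
  refine Fintype.sum_equiv (Equiv.arrowCongr (Equiv.subRight c) (Equiv.refl _)) _ _ fun s => ?_
  rw [Matrix.diag_apply, Matrix.diag_apply, placeAt_of_agree _ fun _ _ => rfl,
    placeAt_of_agree _ fun _ _ => rfl]
  have : restrictArc (x + c) w s =
      restrictArc x w ((Equiv.arrowCongr (Equiv.subRight c) (Equiv.refl _)) s) := by
    funext i
    simp [restrictArc, add_right_comm]
  rw [this]

theorem hs_placeAt {w : ℕ} (hw : w ≤ 2 * L) (x : ZMod (2 * L)) (a b : LocalOp d w) :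
    hs (placeAt x a) (placeAt x b) = (placeAt x (a.conjTranspose * b) : ChainOp d L).trace := by
  rw [hs, placeAt_mul hw, placeAt_conjTranspose]

theorem hs_placeAt_add {w : ℕ} (hw : w ≤ 2 * L) (x c : ZMod (2 * L)) (a b : LocalOp d w) :
    hs (placeAt (x + c) a) (placeAt (x + c) b) = hs (placeAt x a) (placeAt x b) := by
  rw [hs_placeAt hw, hs_placeAt hw, trace_placeAt_add]

theorem conjBy_chainLayer_placeAt {n m : ℕ} (hn : n = 2 * m) (hm : m ≤ L) (x : ZMod (2 * L))
    {G : Gate d} (hG : G ∈ Matrix.unitaryGroup (Fin d × Fin d) ℂ) (A : LocalOp d n) :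
    conjBy (chainLayer L G x) (placeAt x A) =
      placeAt x (rowLayer n G * A * (rowLayer n G).conjTranspose) :=
  chainLayer_conj_placeAt hn hm x hG A

/-- The transfer map is one Floquet period with the leftmost site averaged out after each layer,
which moves the arc by one site each time. -/
theorem placeAt_rightMap (U V : Gate d) (hU : IsDualUnitary U) (hV : IsDualUnitary V) {w : ℕ}
    (hwo : Odd w) (hw : w + 1 ≤ 2 * L) {x : ZMod (2 * L)} (hx : Even x) (a : LocalOp d w) :
    (placeAt (x + 2) (rightMap U V w a) : ChainOp d L) =
      siteAvg (x + 1) (conjBy (chainLayer L V 1)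
        (siteAvg x (conjBy (chainLayer L U 0) (placeAt x a)))) := by
  obtain ⟨m, hm⟩ := hwo
  have hm' : w + 1 = 2 * (m + 1) := by omega
  have hmL : m + 1 ≤ L := by omega
  rw [← chainLayer_of_even U hx, ← chainLayer_of_odd V hx.add_one, ← placeAt_tensorOne hw x,
    conjBy_chainLayer_placeAt hm' hmL x hU.1, siteAvg_placeAt_first hw, map_smul,
    ← placeAt_tensorOne hw (x + 1), conjBy_chainLayer_placeAt hm' hmL (x + 1) hV.1,
    map_smul, siteAvg_placeAt_first hw, smul_smul, add_assoc, one_add_one_eq_two, rightMap,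
    placeAt_smul]
  congr 1
  rw [one_div, sq, mul_inv]

theorem placeAt_leftMap (U V : Gate d) (hU : IsDualUnitary U) (hV : IsDualUnitary V) {w : ℕ}
    (hwo : Odd w) (hw : w + 1 ≤ 2 * L) {x : ZMod (2 * L)} (hx : Odd x) (a : LocalOp d w) :
    (placeAt (x - 2) (leftMap U V w a) : ChainOp d L) =
      siteAvg (x - 2 + (w : ZMod (2 * L))) (conjBy (chainLayer L V 1)
        (siteAvg (x - 1 + (w : ZMod (2 * L))) (conjBy (chainLayer L U 0) (placeAt x a)))) := by
  obtain ⟨m, hm⟩ := hwo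
  have hm' : w + 1 = 2 * (m + 1) := by omega
  have hmL : m + 1 ≤ L := by omega
  have h1 : Even (x - 1) := hx.sub_odd odd_one
  have h2 : Odd (x - 2) := hx.sub_even even_two
  have e1 : ∀ c : LocalOp d w,
      (placeAt (x - 1) c : ChainOp d L) = placeAt (x - 2) (oneTensor c) := by
    intro c
    have e : x - 2 + 1 = x - 1 := by ring
    rw [placeAt_oneTensor hw, e]
  rw [← chainLayer_of_even U h1, ← chainLayer_of_odd V h2]
  have e2 : (placeAt x a : ChainOp d L) = placeAt (x - 1) (oneTensor a) := by
    rw [placeAt_oneTensor hw, sub_add_cancel]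
  rw [e2, conjBy_chainLayer_placeAt hm' hmL (x - 1) hU.1, siteAvg_placeAt_last hw,
    map_smul, e1,
    conjBy_chainLayer_placeAt hm' hmL (x - 2) hV.1, map_smul, siteAvg_placeAt_last hw, smul_smul,
    leftMap, placeAt_smul]
  congr 1
  rw [one_div, sq, mul_inv]

theorem hs_insert_siteAvg {W B C : ChainOp d L} {y z : ZMod (2 * L)}
    (hy : siteAvg y (conjBy W.conjTranspose B) = conjBy W.conjTranspose B)
    (hz : siteAvg z B = B) : hs B (conjBy W C) = hs B (siteAvg z (conjBy W (siteAvg y C))) := by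
  rw [← hs_siteAvg, hz, hs_conjBy, ← hy, hs_siteAvg, ← hs_conjBy]

/-- The two averages cost nothing when tested against an operator `B` at `x + 2`: `B` is trivial at
`x + 1`, and undoing the `V` layer leaves it trivial at `x`, whose gate acts on the trivial sites `x
- 1`, `x`. -/
theorem hs_floquet_right [NeZero d] {U V : Gate d} (hU : IsDualUnitary U) (hV : IsDualUnitary V)
    {w : ℕ} (hwo : Odd w) (hw : w + 3 ≤ 2 * L) {x : ZMod (2 * L)} (hx : Even x)
    (a b : LocalOp d w) :
    hs (placeAt (x + 2) b) (conjBy (floquet L U V) (placeAt x a)) =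
      hs (placeAt (x + 2) b) (placeAt (x + 2) (rightMap U V w a)) := by
  have hB : ∀ k : ℕ, 1 ≤ k → k ≤ 3 → siteAvg (x + 2 - (k : ZMod (2 * L)))
      (placeAt (x + 2) b : ChainOp d L) = placeAt (x + 2) b := fun k h1 h2 =>
    siteAvg_placeAt_off (offArc_sub _ h1 (by omega)) b
  have a1 := hB 1 (by norm_num) (by norm_num)
  have a2 := hB 2 (by norm_num) (by norm_num)
  have a3 := hB 3 (by norm_num) (by norm_num)
  have e1 : x + 2 - ((1 : ℕ) : ZMod (2 * L)) = x + 1 := by push_cast; ring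
  have e2 : x + 2 - ((2 : ℕ) : ZMod (2 * L)) = x := by push_cast; ring
  have e3 : x + 2 - ((3 : ℕ) : ZMod (2 * L)) = x - 1 := by push_cast; ring
  rw [e1] at a1
  rw [e2] at a2
  rw [e3] at a3
  rw [placeAt_rightMap U V hU hV hwo (by omega) hx, conjBy_floquet, LinearMap.comp_apply]
  refine hs_insert_siteAvg ?_ a1
  rw [chainLayer_conjTranspose]
  exact siteAvg_layer (Or.inr (isLightConeAt_of_odd hV.conjTranspose (hx.sub_odd odd_one))) a3 a2 a1

theorem hs_floquet_left [NeZero d] {U V : Gate d} (hU : IsDualUnitary U) (hV : IsDualUnitary V)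
    {w : ℕ} (hwo : Odd w) (hw : w + 3 ≤ 2 * L) {x : ZMod (2 * L)} (hx : Odd x)
    (a b : LocalOp d w) :
    hs (placeAt (x - 2) b) (conjBy (floquet L U V) (placeAt x a)) =
      hs (placeAt (x - 2) b) (placeAt (x - 2) (leftMap U V w a)) := by
  have hB : ∀ k : ℕ, k ≤ 2 → siteAvg (x - 2 + ((w + k : ℕ) : ZMod (2 * L)))
      (placeAt (x - 2) b : ChainOp d L) = placeAt (x - 2) b := fun k h2 =>
    siteAvg_placeAt_off (offArc_add _ (by omega) (by omega)) b
  have a0 := hB 0 (by norm_num)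
  have a1 := hB 1 (by norm_num)
  have a2 := hB 2 (by norm_num)
  have e0 : x - 2 + ((w + 0 : ℕ) : ZMod (2 * L)) = x - 2 + (w : ZMod (2 * L)) := by
    push_cast; ring
  have e0' : x - 2 + ((w + 0 : ℕ) : ZMod (2 * L)) = x - 1 + (w : ZMod (2 * L)) - 1 := by
    push_cast; ring
  have e1 : x - 2 + ((w + 1 : ℕ) : ZMod (2 * L)) = x - 1 + (w : ZMod (2 * L)) := by
    push_cast; ring
  have e2 : x - 2 + ((w + 2 : ℕ) : ZMod (2 * L)) = x - 1 + (w : ZMod (2 * L)) + 1 := by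
    push_cast; ring
  have a0' := a0
  rw [e0] at a0
  rw [e0'] at a0'
  rw [e1] at a1
  rw [e2] at a2
  rw [placeAt_leftMap U V hU hV hwo (by omega) hx, conjBy_floquet, LinearMap.comp_apply]
  refine hs_insert_siteAvg ?_ a0
  rw [chainLayer_conjTranspose]
  refine siteAvg_layer (Or.inl (isLightConeAt_of_odd hV.conjTranspose ?_)) a0' a1 a2
  exact (hx.sub_odd odd_one).add_odd hwo.natCast

/-- If the conjugate of `a` at `x` overlaps with operators at `x'` like `c` at `x'` does, and `c` is
a phase times `a`, then the conjugate is `c` at `x'`. -/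
theorem conj_placeAt_eq_smul {W : ChainOp d L} (hW : W * W.conjTranspose = 1) {w : ℕ}
    (hw : w ≤ 2 * L) {x x' : ZMod (2 * L)} {a : LocalOp d w} {lam : ℂ} (hlam : ‖lam‖ = 1)
    (h : hs (placeAt x' a) (conjBy W (placeAt x a)) = hs (placeAt x' a) (placeAt x' (lam • a))) :
    conjBy W (placeAt x a) = lam • placeAt x' a := by
  have hl : star lam * lam = 1 := by
    rw [← starRingEnd_apply, Complex.conj_mul', hlam]
    simp
  have h1 : hs (placeAt x a) (placeAt x a) = hs (placeAt x' a) (placeAt x' a) := by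
    have := hs_placeAt_add hw x' (x - x') a a
    rwa [add_sub_cancel] at this
  symm
  -- The equality case of Cauchy–Schwarz: the two operators have equal norms, and their overlap
  -- equals the squared norm.
  rw [← sub_eq_zero, ← hs_self_eq_zero, hs_self_sub_of_isometry, hs_conjBy_conjBy hW, hs_smul_left,
    hs_smul_right, ← mul_assoc, hl, h1, one_mul, sub_self]
  rw [hs_smul_left, h, placeAt_smul, hs_smul_left, hs_smul_right]

theorem isRightSoliton_of_eigen [NeZero d] {U V : Gate d} (hU : IsDualUnitary U)
    (hV : IsDualUnitary V) {w : ℕ} (hwo : Odd w) (hw : w + 3 ≤ 2 * L) {a : LocalOp d w} {lam : ℂ}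
    (ha : IsBoundaryTraceless a) (hlam : ‖lam‖ = 1) (he : rightMap U V w a = lam • a) :
    IsRightSoliton (floquet L U V) a lam := by
  refine ⟨ha, hlam, fun x hx => ?_⟩
  refine conj_placeAt_eq_smul (floquet_mul_conjTranspose hU hV) (by omega) hlam ?_
  rw [hs_floquet_right hU hV hwo hw hx, he]

theorem isLeftSoliton_of_eigen [NeZero d] {U V : Gate d} (hU : IsDualUnitary U)
    (hV : IsDualUnitary V) {w : ℕ} (hwo : Odd w) (hw : w + 3 ≤ 2 * L) {a : LocalOp d w} {lam : ℂ}
    (ha : IsBoundaryTraceless a) (hlam : ‖lam‖ = 1) (he : leftMap U V w a = lam • a) :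
    IsLeftSoliton (floquet L U V) a lam := by
  refine ⟨ha, hlam, fun x hx => ?_⟩
  refine conj_placeAt_eq_smul (floquet_mul_conjTranspose hU hV) (by omega) hlam ?_
  rw [hs_floquet_left hU hV hwo hw hx, he]

theorem eq_of_hs_placeAt_eq [NeZero d] {w : ℕ} (hw : w ≤ 2 * L) {x : ZMod (2 * L)}
    {a a' : LocalOp d w} {C : ChainOp d L} (hC : C = placeAt x a)
    (h : ∀ b : LocalOp d w, hs (placeAt x b) C = hs (placeAt x b) (placeAt x a')) : a = a' := by
  refine placeAt_injective hw x (sub_eq_zero.1 ?_)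
  rw [← placeAt_sub, ← hs_self_eq_zero]
  nth_rewrite 2 [placeAt_sub]
  rw [hs_sub_right, ← h, hC, sub_self]

/-- If the evolved operator already lies on the target arc, compressing it there changes nothing. -/
theorem rightMap_eq_of_conj [NeZero d] {U V : Gate d} (hU : IsDualUnitary U)
    (hV : IsDualUnitary V) {w : ℕ} (hwo : Odd w) (hw : w + 3 ≤ 2 * L) {x : ZMod (2 * L)}
    (hx : Even x) {a a' : LocalOp d w}
    (h : conjBy (floquet L U V) (placeAt x a) = placeAt (x + 2) a') : rightMap U V w a = a' :=
  (eq_of_hs_placeAt_eq (by omega) h fun b => hs_floquet_right hU hV hwo hw hx a b).symm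

theorem leftMap_eq_of_conj [NeZero d] {U V : Gate d} (hU : IsDualUnitary U)
    (hV : IsDualUnitary V) {w : ℕ} (hwo : Odd w) (hw : w + 3 ≤ 2 * L) {x : ZMod (2 * L)}
    (hx : Odd x) {a a' : LocalOp d w}
    (h : conjBy (floquet L U V) (placeAt x a) = placeAt (x - 2) a') : leftMap U V w a = a' :=
  (eq_of_hs_placeAt_eq (by omega) h fun b => hs_floquet_left hU hV hwo hw hx a b).symm

end Floquet

/-! ### Spectral decomposition along finite orbits. -/

section Spectral

variable {d w : ℕ}

theorem tensorOne_add (a b : LocalOp d w) : tensorOne (a + b) = tensorOne a + tensorOne b :=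
  Matrix.ext fun _ _ => add_mul _ _ _

theorem tensorOne_smul (c : ℂ) (a : LocalOp d w) : tensorOne (c • a) = c • tensorOne a :=
  Matrix.ext fun _ _ => mul_assoc _ _ _

theorem oneTensor_add (a b : LocalOp d w) : oneTensor (a + b) = oneTensor a + oneTensor b :=
  Matrix.ext fun _ _ => mul_add _ _ _

theorem oneTensor_smul (c : ℂ) (a : LocalOp d w) : oneTensor (c • a) = c • oneTensor a :=
  Matrix.ext fun _ _ => mul_left_comm _ _ _

theorem traceFirst_add (a b : LocalOp d (w + 1)) :
    traceFirst (a + b) = traceFirst a + traceFirst b :=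
  Matrix.ext fun _ _ => Finset.sum_add_distrib

theorem traceFirst_smul (c : ℂ) (a : LocalOp d (w + 1)) :
    traceFirst (c • a) = c • traceFirst a :=
  Matrix.ext fun _ _ => (Finset.mul_sum _ _ _).symm

theorem traceLast_add (a b : LocalOp d (w + 1)) :
    traceLast (a + b) = traceLast a + traceLast b :=
  Matrix.ext fun _ _ => Finset.sum_add_distrib

theorem traceLast_smul (c : ℂ) (a : LocalOp d (w + 1)) :
    traceLast (c • a) = c • traceLast a :=
  Matrix.ext fun _ _ => (Finset.mul_sum _ _ _).symm

/-- `rightMap` as a linear map. -/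
noncomputable def rightMapLin (U V : Gate d) (w : ℕ) : LocalOp d w →ₗ[ℂ] LocalOp d w where
  toFun := rightMap U V w
  map_add' a b := by
    simp only [rightMap, tensorOne_add, mul_add, add_mul, traceFirst_add, smul_add]
  map_smul' c a := by
    simp only [rightMap, tensorOne_smul, Matrix.mul_smul, Matrix.smul_mul, traceFirst_smul,
      RingHom.id_apply]
    rw [smul_comm]

/-- `leftMap` as a linear map. -/
noncomputable def leftMapLin (U V : Gate d) (w : ℕ) : LocalOp d w →ₗ[ℂ] LocalOp d w where
  toFun := leftMap U V w
  map_add' a b := by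
    simp only [leftMap, oneTensor_add, mul_add, add_mul, traceLast_add, smul_add]
  map_smul' c a := by
    simp only [leftMap, oneTensor_smul, Matrix.mul_smul, Matrix.smul_mul, traceLast_smul,
      RingHom.id_apply]
    rw [smul_comm]

/-- The operators whose partial traces over both boundary sites vanish, as a subspace. -/
def boundaryTraceless (d w : ℕ) : Submodule ℂ (LocalOp d w) where
  carrier := {a | IsBoundaryTraceless a}
  zero_mem' := fun _ _ _ _ => Finset.sum_const_zero
  add_mem' := fun {a b} ha hb j hj s t =>
    Finset.sum_add_distrib.trans (by rw [ha j hj s t, hb j hj s t, add_zero])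
  smul_mem' := fun c a ha j hj s t =>
    (Finset.mul_sum _ _ _).symm.trans (by rw [ha j hj s t, mul_zero])

theorem sum_fin_succ_eq {M : Type*} [AddCommMonoid M] {L : ℕ} {f : ℕ → M} (h : f L = f 0) :
    ∑ j : Fin L, f ((j : ℕ) + 1) = ∑ j : Fin L, f (j : ℕ) := by
  rw [Fin.sum_univ_eq_sum_range (fun j => f (j + 1)), Fin.sum_univ_eq_sum_range f]
  cases L with
  | zero => simp
  | succ m => rw [Finset.sum_range_succ, h, Finset.sum_range_succ' f]

theorem sum_primitive_root_pow {L : ℕ} {ζ : ℂ} (hζ : IsPrimitiveRoot ζ L) {n : ℕ} (h0 : n ≠ 0)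
    (hn : n < L) : ∑ m : Fin L, (ζ ^ (m : ℕ)) ^ n = 0 := by
  have h1 : ζ ^ n ≠ 1 := hζ.pow_ne_one_of_pos_of_lt h0 hn
  have h2 : (ζ ^ n) ^ L = 1 := by rw [← pow_mul, mul_comm, pow_mul, hζ.pow_eq_one, one_pow]
  have h3 : ∀ m : Fin L, (ζ ^ (m : ℕ)) ^ n = (ζ ^ n) ^ (m : ℕ) := fun m => by
    rw [← pow_mul, ← pow_mul, mul_comm]
  rw [Finset.sum_congr rfl fun m _ => h3 m, Fin.sum_univ_eq_sum_range (fun m => (ζ ^ n) ^ m),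
    geom_sum_eq h1, h2, sub_self, zero_div]

/-- A vector of finite order under `M` is a linear combination of solitons of the same order. -/
theorem IsSolitonBasis.exists_coeff {M : LocalOp d w →ₗ[ℂ] LocalOp d w} {r : ℕ}
    {a : Fin r → LocalOp d w} {lam : Fin r → ℂ} (hb : IsSolitonBasis M a lam) {L : ℕ} [NeZero L]
    {v : LocalOp d w} (hv : ∀ n, IsBoundaryTraceless ((M ^ n) v)) (hL : (M ^ L) v = v) :
    ∃ c : Fin r → ℂ, (∀ k, lam k ^ L ≠ 1 → c k = 0) ∧
      ∀ n, (M ^ n) v = ∑ k, (c k * lam k ^ n) • a k := by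
  obtain ⟨ζ, hζ⟩ : ∃ ζ : ℂ, IsPrimitiveRoot ζ L := ⟨_, Complex.isPrimitiveRoot_exp L (NeZero.ne L)⟩
  have hζ0 : ζ ≠ 0 := hζ.ne_zero (NeZero.ne L)
  -- Summed over one period in `n`, these terms give the Fourier component of the orbit of `v` on
  -- which `M` acts as `(ζ ^ m)⁻¹`.
  let g : ℕ → ℕ → LocalOp d w := fun m n => (ζ ^ m) ^ n • (M ^ n) v
  have hspan : v ∈ Submodule.span ℂ (Set.range a) := by
    have h1 : ∀ m : Fin L, ∑ n : Fin L, g m n ∈ Submodule.span ℂ (Set.range a) := by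
      intro m
      refine hb.complete _ (ζ ^ (m : ℕ))⁻¹ ?_ ?_ ?_
      · exact (boundaryTraceless d w).sum_mem fun n _ =>
          (boundaryTraceless d w).smul_mem _ (hv n)
      · rw [norm_inv, norm_pow, hζ.norm'_eq_one (NeZero.ne L), one_pow, inv_one]
      · have h2 : ∀ n : ℕ, M (g m n) = (ζ ^ (m : ℕ))⁻¹ • g m (n + 1) := by
          intro n
          simp only [g]
          rw [map_smul, smul_smul, pow_succ' (ζ ^ (m : ℕ)),
            inv_mul_cancel_left₀ (pow_ne_zero _ hζ0), pow_succ' M, Module.End.mul_apply]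
        have h3 : g m L = g m 0 := by
          simp only [g]
          rw [hL, ← pow_mul, mul_comm, pow_mul, hζ.pow_eq_one]
          simp
        rw [map_sum, Finset.sum_congr rfl fun n _ => h2 _, ← Finset.smul_sum, sum_fin_succ_eq h3]
    -- Fourier inversion: summing over `m` first kills every `n ≠ 0`.
    have h4 : ∑ m : Fin L, ∑ n : Fin L, g m n = (L : ℂ) • v := by
      rw [Finset.sum_comm, Finset.sum_eq_single (0 : Fin L)]
      · simp [g, ← Nat.cast_smul_eq_nsmul ℂ]
      · intro n _ hn
        simp only [g]
        rw [← Finset.sum_smul, sum_primitive_root_pow hζ (Fin.val_ne_zero_iff.2 hn) n.2,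
          zero_smul]
      · simp
    have h5 := (Submodule.span ℂ (Set.range a)).smul_mem ((L : ℂ)⁻¹)
      (h4 ▸ Submodule.sum_mem _ fun m _ => h1 m)
    rwa [inv_smul_smul₀ (Nat.cast_ne_zero.2 (NeZero.ne L))] at h5
  obtain ⟨c, hc⟩ := (Submodule.mem_span_range_iff_exists_fun ℂ).1 hspan
  have hpow : ∀ n, (M ^ n) v = ∑ k, (c k * lam k ^ n) • a k := by
    intro n
    induction n with
    | zero => simp [hc]
    | succ n ih =>
      rw [pow_succ', Module.End.mul_apply, ih, map_sum]
      refine Finset.sum_congr rfl fun k _ => ?_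
      rw [map_smul, hb.eigen, smul_smul, pow_succ, mul_assoc]
  refine ⟨c, fun k hk => ?_, hpow⟩
  have h6 : ∑ k, (c k * lam k ^ L - c k) • a k = 0 := by
    simp only [sub_smul, Finset.sum_sub_distrib]
    rw [← hpow, hL, hc, sub_self]
  have h7 := Fintype.linearIndependent_iff.1 hb.linearIndependent _ h6 k
  have h8 : c k * (lam k ^ L - 1) = 0 := by rw [← h7]; ring
  exact (mul_eq_zero.1 h8).resolve_right (sub_ne_zero.2 hk)

end Spectral

/-! ### Assembling charges from translated densities. -/

section Charges

variable {d L : ℕ} [NeZero L]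

theorem sum_zmod_two_mul {M : Type*} [AddCommMonoid M] (f : ZMod (2 * L) → M) :
    ∑ x, f x = ∑ n : Fin L, f (2 * ((n : ℕ) : ZMod (2 * L))) +
      ∑ n : Fin L, f (2 * ((n : ℕ) : ZMod (2 * L)) + 1) := by
  rw [← (sitePairs (L := L) 0).sum_comp, Fintype.sum_prod_type, ← Finset.sum_add_distrib]
  refine Finset.sum_congr rfl fun j _ => ?_
  rw [Fin.sum_univ_two, sitePairs_apply, sitePairs_apply]
  simp

theorem isConserved_rightCharge {W : ChainOp d L} {w : ℕ} {a : LocalOp d w} {lam : ℂ}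
    (h : IsRightSoliton W a lam) (hlam : lam ^ L = 1) : IsConserved W (rightCharge L a lam) := by
  let f : ℕ → ChainOp d L := fun n => lam ^ n • placeAt (2 * (n : ZMod (2 * L))) a
  have h1 : ∀ n, conjBy W (f n) = f (n + 1) := by
    intro n
    simp only [f]
    rw [map_smul, conjBy_apply, h.2.2 _ (even_two_mul _), smul_smul, pow_succ]
    push_cast
    rw [mul_add, mul_one]
  have h2 : f L = f 0 := by
    simp only [f]
    rw [hlam, two_mul_natCast_self]
    simp
  change conjBy W (∑ n : Fin L, f n) = ∑ n : Fin L, f n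
  rw [map_sum, Finset.sum_congr rfl fun n _ => h1 _, sum_fin_succ_eq h2]

theorem isConserved_leftCharge {W : ChainOp d L} {w : ℕ} {a : LocalOp d w} {lam : ℂ}
    (h : IsLeftSoliton W a lam) (hlam : lam ^ L = 1) : IsConserved W (leftCharge L a lam) := by
  have h0 : lam ≠ 0 := by
    intro h0
    have := h.2.1
    rw [h0, norm_zero] at this
    exact zero_ne_one this
  let f : ℕ → ChainOp d L := fun n => lam⁻¹ ^ n • placeAt (2 * (n : ZMod (2 * L)) + 1) a
  have h1 : ∀ n, conjBy W (f (n + 1)) = f n := by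
    intro n
    simp only [f]
    rw [map_smul, conjBy_apply, h.2.2 _ (odd_two_mul_add_one _), smul_smul, pow_succ, mul_assoc,
      inv_mul_cancel₀ h0, mul_one]
    congr 2
    push_cast
    ring
  have h2 : f L = f 0 := by
    simp only [f]
    rw [inv_pow, hlam, two_mul_natCast_self]
    simp
  change conjBy W (∑ n : Fin L, f n) = ∑ n : Fin L, f n
  rw [← sum_fin_succ_eq h2, map_sum, Finset.sum_congr rfl fun n _ => h1 _, sum_fin_succ_eq h2]

theorem exists_coeff_rightCharge {w : ℕ} {M : LocalOp d w →ₗ[ℂ] LocalOp d w}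
    {r : ℕ} {a : Fin r → LocalOp d w} {lam : Fin r → ℂ} (hb : IsSolitonBasis M a lam)
    {q : ZMod (2 * L) → LocalOp d w} (hq : ∀ x, IsBoundaryTraceless (q x))
    (hM : ∀ x, Even x → M (q x) = q (x + 2)) :
    ∃ c : Fin r → ℂ, (∀ k, lam k ^ L ≠ 1 → c k = 0) ∧
      ∑ n : Fin L, placeAt (2 * ((n : ℕ) : ZMod (2 * L))) (q (2 * ((n : ℕ) : ZMod (2 * L)))) =
        ∑ k, c k • rightCharge L (a k) (lam k) := by
  have h1 : ∀ n : ℕ, (M ^ n) (q 0) = q (2 * (n : ZMod (2 * L))) := by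
    intro n
    induction n with
    | zero => simp
    | succ n ih =>
      rw [pow_succ', Module.End.mul_apply, ih, hM _ (even_two_mul _)]
      push_cast
      rw [mul_add, mul_one]
  obtain ⟨c, hc, hpow⟩ := hb.exists_coeff (L := L) (v := q 0) (fun n => by rw [h1]; exact hq _)
    (by rw [h1, two_mul_natCast_self])
  refine ⟨c, hc, ?_⟩
  simp only [rightCharge, Finset.smul_sum]
  rw [Finset.sum_comm]
  refine Finset.sum_congr rfl fun n _ => ?_
  rw [← h1, hpow, ← placeAtLin_apply, map_sum]
  refine Finset.sum_congr rfl fun k _ => ?_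
  rw [map_smul, smul_smul, placeAtLin_apply]

theorem exists_coeff_leftCharge {w : ℕ} {M : LocalOp d w →ₗ[ℂ] LocalOp d w}
    {r : ℕ} {a : Fin r → LocalOp d w} {lam : Fin r → ℂ} (hb : IsSolitonBasis M a lam)
    {q : ZMod (2 * L) → LocalOp d w} (hq : ∀ x, IsBoundaryTraceless (q x))
    (hM : ∀ x, Odd x → M (q x) = q (x - 2)) :
    ∃ c : Fin r → ℂ, (∀ k, lam k ^ L ≠ 1 → c k = 0) ∧
      ∑ n : Fin L, placeAt (2 * ((n : ℕ) : ZMod (2 * L)) + 1)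
        (q (2 * ((n : ℕ) : ZMod (2 * L)) + 1)) = ∑ k, c k • leftCharge L (a k) (lam k) := by
  have h1 : ∀ n : ℕ, (M ^ n) (q 1) = q (1 - 2 * (n : ZMod (2 * L))) := by
    intro n
    induction n with
    | zero => simp
    | succ n ih =>
      rw [pow_succ', Module.End.mul_apply, ih, hM _ (odd_one.sub_even (even_two_mul _))]
      congr 1
      push_cast
      ring
  obtain ⟨c, hc, hpow⟩ := hb.exists_coeff (L := L) (v := q 1) (fun n => by rw [h1]; exact hq _)
    (by rw [h1, two_mul_natCast_self, sub_zero])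
  refine ⟨c, hc, ?_⟩
  simp only [leftCharge, Finset.smul_sum]
  rw [Finset.sum_comm]
  refine Finset.sum_congr rfl fun n _ => ?_
  -- Left-movers reach `2 n + 1` from site `1` only by going the other way around the ring, in `L -
  -- n` periods. Where `lam k ^ L = 1`, the resulting power is the `lam k ^ (-n)` of the charge;
  -- elsewhere the coefficient is zero.
  have h2 : q (2 * ((n : ℕ) : ZMod (2 * L)) + 1) = (M ^ (L - (n : ℕ))) (q 1) := by
    rw [h1]
    congr 1
    rw [Nat.cast_sub n.2.le]
    linear_combination two_mul_natCast_self L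
  rw [h2, hpow, ← placeAtLin_apply, map_sum]
  refine Finset.sum_congr rfl fun k _ => ?_
  rw [map_smul, smul_smul, placeAtLin_apply]
  by_cases hk : lam k ^ L = 1
  · congr 2
    rw [inv_pow]
    exact eq_inv_of_mul_eq_one_left (by rw [← pow_add, Nat.sub_add_cancel n.2.le, hk])
  · rw [hc k hk, zero_mul, zero_mul]

end Charges

/-! ### The classification theorem. -/

theorem theorem1 (d L : ℕ) [NeZero d] [NeZero L] (U V : Gate d)
    (hU : IsDualUnitary U) (hV : IsDualUnitary V)
    -- the right-moving solitons `a w k`, with phases `lam w k`, for each odd width `w`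
    (r : ℕ → ℕ) (a : ∀ w, Fin (r w) → LocalOp d w) (lam : ∀ w, Fin (r w) → ℂ)
    (ha : ∀ w ∈ Finset.Icc 1 (L - 4), Odd w → IsSolitonBasis (rightMap U V w) (a w) (lam w))
    -- the left-moving solitons `b w l`, with phases `mu w l`, for each odd width `w`
    (s : ℕ → ℕ) (b : ∀ w, Fin (s w) → LocalOp d w) (mu : ∀ w, Fin (s w) → ℂ)
    (hb : ∀ w ∈ Finset.Icc 1 (L - 4), Odd w → IsSolitonBasis (leftMap U V w) (b w) (mu w))
    -- the conserved quantity
    (q : ∀ w, ZMod (2 * L) → LocalOp d w)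
    (hq : ∀ w ∈ Finset.Icc 1 (L - 4), ∀ x, IsBoundaryTraceless (q w x))
    (Q : ChainOp d L)
    (hQ : Q = ∑ w ∈ Finset.Icc 1 (L - 4), ∑ x : ZMod (2 * L), placeAt x (q w x))
    (hcons : IsConserved (floquet L U V) Q) :
    (∀ w ∈ Finset.Icc 1 (L - 4), Odd w →
      (∀ k, IsRightSoliton (floquet L U V) (a w k) (lam w k) ∧
        (lam w k ^ L = 1 → IsConserved (floquet L U V) (rightCharge L (a w k) (lam w k)))) ∧
      (∀ l, IsLeftSoliton (floquet L U V) (b w l) (mu w l) ∧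
        (mu w l ^ L = 1 → IsConserved (floquet L U V) (leftCharge L (b w l) (mu w l))))) ∧
    ∃ (α : ∀ w, Fin (r w) → ℂ) (β : ∀ w, Fin (s w) → ℂ),
      (∀ w k, lam w k ^ L ≠ 1 → α w k = 0) ∧
      (∀ w l, mu w l ^ L ≠ 1 → β w l = 0) ∧
      Q = ∑ w ∈ (Finset.Icc 1 (L - 4)).filter (fun w => Odd w),
        (∑ k, α w k • rightCharge L (a w k) (lam w k) +
          ∑ l, β w l • leftCharge L (b w l) (mu w l)) := by
  have hcases : ∀ w ∈ Finset.Icc 1 (L - 4), 1 ≤ w ∧ w + 4 ≤ L := by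
    intro w hw
    rw [Finset.mem_Icc] at hw
    omega
  constructor
  · intro w hw hwo
    have hwL := hcases w hw
    refine ⟨fun k => ?_, fun l => ?_⟩
    · have h := isRightSoliton_of_eigen (L := L) hU hV hwo (by omega) ((ha w hw hwo).traceless k)
        ((ha w hw hwo).unimodular k) ((ha w hw hwo).eigen k)
      exact ⟨h, isConserved_rightCharge h⟩
    · have h := isLeftSoliton_of_eigen (L := L) hU hV hwo (by omega) ((hb w hw hwo).traceless l)
        ((hb w hw hwo).unimodular l) ((hb w hw hwo).eigen l)
      exact ⟨h, isConserved_leftCharge h⟩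
  -- For small `L` the range of widths is empty (with truncated subtraction), so `Q = 0`; the bound
  -- `N + 4 ≤ L` could otherwise fail for `N = L - 4`.
  by_cases hL : L < 5
  · have he : Finset.Icc 1 (L - 4) = ∅ := Finset.Icc_eq_empty (by omega)
    exact ⟨fun _ _ => 0, fun _ _ => 0, fun _ _ _ => rfl, fun _ _ _ => rfl, by rw [hQ, he]; simp⟩
  have hF : IsConservedFamily (conjBy (floquet L U V)) (conjBy (floquet L U V).conjTranspose)
      (L - 4) (fun w x => placeAt x (q w x)) := by
    refine ⟨by omega, isBrickStep_floquet hU hV, isBrickStep_floquet_conjTranspose hU hV,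
      hs_conjBy _, hs_conjBy_conjBy (floquet_mul_conjTranspose hU hV), fun w hw x => ?_, ?_⟩
    · have hwL := hcases w hw
      exact isBand_placeAt hwL.1 (by omega) x (hq w hw x)
    · rw [← hQ]
      exact hcons
  have hα : ∀ w, ∃ c : Fin (r w) → ℂ, (∀ k, lam w k ^ L ≠ 1 → c k = 0) ∧
      (w ∈ Finset.Icc 1 (L - 4) → Odd w →
        ∑ n : Fin L, placeAt (2 * ((n : ℕ) : ZMod (2 * L))) (q w (2 * ((n : ℕ) : ZMod (2 * L)))) =
          ∑ k, c k • rightCharge L (a w k) (lam w k)) := by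
    intro w
    by_cases hw : w ∈ Finset.Icc 1 (L - 4) ∧ Odd w
    · have hwL := hcases w hw.1
      obtain ⟨c, hc, hsum⟩ := exists_coeff_rightCharge (M := rightMapLin U V w) (L := L)
        (ha w hw.1 hw.2) (hq w hw.1) fun x hx =>
          rightMap_eq_of_conj hU hV hw.2 (by omega) hx (hF.map_of_even hw.1 hx)
      exact ⟨c, hc, fun _ _ => hsum⟩
    -- Widths that do not occur in the sum get zero coefficients, so that the vanishing condition
    -- holds for every `w`.
    · exact ⟨0, fun _ _ => rfl, fun h1 h2 => absurd ⟨h1, h2⟩ hw⟩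
  have hβ : ∀ w, ∃ c : Fin (s w) → ℂ, (∀ k, mu w k ^ L ≠ 1 → c k = 0) ∧
      (w ∈ Finset.Icc 1 (L - 4) → Odd w →
        ∑ n : Fin L, placeAt (2 * ((n : ℕ) : ZMod (2 * L)) + 1)
          (q w (2 * ((n : ℕ) : ZMod (2 * L)) + 1)) =
          ∑ k, c k • leftCharge L (b w k) (mu w k)) := by
    intro w
    by_cases hw : w ∈ Finset.Icc 1 (L - 4) ∧ Odd w
    · have hwL := hcases w hw.1
      obtain ⟨c, hc, hsum⟩ := exists_coeff_leftCharge (M := leftMapLin U V w) (L := L)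
        (hb w hw.1 hw.2) (hq w hw.1) fun x hx =>
          leftMap_eq_of_conj hU hV hw.2 (by omega) hx (hF.map_of_odd hw.1 hw.2 hx)
      exact ⟨c, hc, fun _ _ => hsum⟩
    · exact ⟨0, fun _ _ => rfl, fun h1 h2 => absurd ⟨h1, h2⟩ hw⟩
  choose α hα0 hα1 using hα
  choose β hβ0 hβ1 using hβ
  refine ⟨α, β, hα0, hβ0, ?_⟩
  rw [hQ, Finset.sum_filter]
  refine Finset.sum_congr rfl fun w hw => ?_
  split_ifs with hwo
  · rw [sum_zmod_two_mul, hα1 w hw hwo, hβ1 w hw hwo]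
  · exact Finset.sum_eq_zero fun x _ =>
      hF.eq_zero_of_even_width hw (Nat.not_odd_iff_even.1 hwo) x
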